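/- Let $n\geq 3$ be an integer and let $a_1,\ldots,a_n\in\mathbb{Z}$. For $\alpha\in\mathbb{Z}$ consider the congruence $$a_1x_1+\cdots+a_nx_n\equiv\alpha \pmod n. \tag{$*_\alpha$}$$ 1. Suppose that for some distinct $j,k,l\in\{1,\ldots,n\}$ we have $a_j-a_l\equiv -a_k+a_l \pmod n$, $\gcd(a_j-a_l,n)=1$, and $a_i\equiv a_l\pmod n$ for all $i\in\{1,\ldots,n\}\setminus\{j,k\}$. Then there is a solution $(x_1,\ldots,x_n)\in\mathbb{Z}^n$ to $(*_1)$ with the $x_i$ pairwise distinct modulo $n$, but there is some integer $\alpha\neq 1$ for which there is no solution $(x_1,\ldots,x_n)\in\mathbb{Z}^n$ to $(*_\alpha)$ with the $x_i$ pairwise distinct modulo $n$. 2. Otherwise (if no such $j,k,l$ exist), the following are equivalent. (a) For every $\alpha\in\mathbb{Z}$, there is a solution $(x_1,\ldots,x_n)\in\mathbb{Z}^n$ to $(*_\alpha)$ with the $x_i$ pairwise distinct modulo $n$. (b) For some $i\in\{1,\ldots,n\}$, $\gcd(a_1-a_i,\ldots,a_n-a_i,n)=1$. -/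

import Mathlib

/-- The congruence `a₁x₁ + ⋯ + aₙxₙ ≡ α (mod n)` has an integer solution whose entries are
pairwise distinct modulo `n`. -/
def HasDistinctSolution (n : ℕ) (a : Fin n → ℤ) (α : ℤ) : Prop :=
  ∃ x : Fin n → ℤ,
    (∀ i j : Fin n, i ≠ j → ¬ x i ≡ x j [ZMOD (n : ℤ)]) ∧
      ∑ i, a i * x i ≡ α [ZMOD (n : ℤ)]

/-- The exceptional configuration of coefficients: for some distinct `j, k, l`,
`a_j - a_l ≡ -a_k + a_l (mod n)`, `gcd(a_j - a_l, n) = 1`, and all `a_i` with `i ≠ j, k` are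
congruent to `a_l`. -/
def IsExceptional (n : ℕ) (a : Fin n → ℤ) : Prop :=
  ∃ j k l : Fin n, j ≠ k ∧ j ≠ l ∧ k ≠ l ∧
    a j - a l ≡ -a k + a l [ZMOD (n : ℤ)] ∧
    Int.gcd (a j - a l) (n : ℤ) = 1 ∧
    ∀ i : Fin n, i ≠ j → i ≠ k → a i ≡ a l [ZMOD (n : ℤ)]

/-! Put K = 0 + 1 + ... + (n-1). The x_i form a complete residue system, so their sum is K modulo n.
Condition (b) says that for no prime p dividing n are all a_i congruent modulo p (`SpreadOn`). It is
necessary: coefficients all congruent to c modulo p force the weighted sum to be cK modulo p. In the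
exceptional case the weighted sum is a_l K + (a_j - a_l)(x_j - x_k), which takes every value except
a_l K (`ExceptionalOn.solvableOn_iff`); the value 1 is not the missing one, because 2K ≡ 0 and n ≥
3.

Sufficiency is a strong induction on n (`solvableOn_of_spreadOn`), over arbitrary finite index sets
so that it applies to subfamilies. For prime n, Cauchy-Davenport applied to small blocks of indices
produces all residues (`card_le_card_labelSums`); families in which all but two coefficients agree
are solved directly (`solvableOn_of_pair`).

For n = qN with q prime, first make the sum right modulo q, then relabel one residue class of labels
modulo q. The class has N indices, and relabelling it changes the sum by q times a quantity that
matters modulo N, so the induction hypothesis finishes if the class is spread and not exceptional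
modulo N. An exceptional class misses only one value, and exchanging two labels in another class
moves the target unless the two coefficients agree modulo N. So the lift fails only if the class is
exceptional and every other class is constant modulo N (`solvableOn_or_of_class`). Such rigid
configurations are avoided by other choices of labels, or have all but two coefficients congruent to
some c modulo N; then writing a_i = c + N b_i separates the problems modulo N and modulo q
(`solvableOn_of_pair_mod`).

The starting labelling is immediate if some prime q singles out one coefficient, since only its
label matters modulo q (`solvableOn_of_single_mod`). Otherwise q is the least prime factor, a small
set of indices keeps the class spread, and the prime case applied to q other indices corrects the
sum modulo q (`exists_solution_mod_prime`, `solvableOn_of_no_single_mod`). -/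

/-- The values of `y` on `P` are pairwise incongruent modulo `n`. -/
def DistinctModOn {ι : Type*} (n : ℕ) (P : Finset ι) (y : ι → ℤ) : Prop :=
  ∀ i ∈ P, ∀ j ∈ P, y i ≡ y j [ZMOD n] → i = j

/-- The congruence `∑ a i * y i ≡ α (mod n)`, summed over `P`, has a solution with entries
distinct modulo `n`. -/
def SolvableOn {ι : Type*} (n : ℕ) (P : Finset ι) (a : ι → ℤ) (α : ℤ) : Prop :=
  ∃ y : ι → ℤ, DistinctModOn n P y ∧ ∑ i ∈ P, a i * y i ≡ α [ZMOD n]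

/-- All values of `a` on `P` are congruent modulo `n`. -/
def ConstModOn {ι : Type*} (n : ℕ) (P : Finset ι) (a : ι → ℤ) : Prop :=
  ∀ i ∈ P, ∀ j ∈ P, a i ≡ a j [ZMOD n]

/-- The differences of the values of `a` on `P` generate the unit ideal modulo `n`. -/
def SpreadOn {ι : Type*} (n : ℕ) (P : Finset ι) (a : ι → ℤ) : Prop :=
  ∀ p : ℕ, p.Prime → p ∣ n → ¬ ConstModOn p P a

/-- The version of `IsExceptional` for coefficients indexed by a finite set. -/
def ExceptionalOn {ι : Type*} (n : ℕ) (P : Finset ι) (a : ι → ℤ) : Prop :=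
  ∃ j ∈ P, ∃ k ∈ P, ∃ l ∈ P, j ≠ k ∧ j ≠ l ∧ k ≠ l ∧
    a j + a k ≡ 2 * a l [ZMOD n] ∧ IsCoprime (a j - a l) (n : ℤ) ∧
    ∀ i ∈ P, i ≠ j → i ≠ k → a i ≡ a l [ZMOD n]

/-! ### Complete residue systems and linear congruences -/

section Basic

variable {ι : Type*} {n : ℕ} {P Q W : Finset ι} {a y f : ι → ℤ}

theorem Int.ModEq.of_dvd_nat {m n : ℕ} {x y : ℤ} (h : x ≡ y [ZMOD n]) (hd : m ∣ n) :
    x ≡ y [ZMOD m] :=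
  h.of_dvd (Int.natCast_dvd_natCast.2 hd)

theorem DistinctModOn.mono (h : DistinctModOn n P y) (hQ : Q ⊆ P) : DistinctModOn n Q y :=
  fun i hi j hj => h i (hQ hi) j (hQ hj)

theorem ConstModOn.mono (h : ConstModOn n P a) (hQ : Q ⊆ P) : ConstModOn n Q a :=
  fun i hi j hj => h i (hQ hi) j (hQ hj)

theorem SpreadOn.mono (h : SpreadOn n Q a) (hQ : Q ⊆ P) : SpreadOn n P a :=
  fun p hp hd hc => h p hp hd (hc.mono hQ)

theorem SpreadOn.of_dvd {m : ℕ} (h : SpreadOn n P a) (hm : m ∣ n) : SpreadOn m P a :=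
  fun p hp hd => h p hp (hd.trans hm)

theorem spreadOn_of_isCoprime {i j : ι} (hi : i ∈ P) (hj : j ∈ P)
    (h : IsCoprime (a i - a j) (n : ℤ)) : SpreadOn n P a := by
  intro p hp hd hc
  have h1 : (p : ℤ) ∣ a i - a j := (hc j hj i hi).dvd
  have h2 : (p : ℤ) ∣ n := Int.natCast_dvd_natCast.2 hd
  have := h.isUnit_of_dvd' h1 h2
  exact (Nat.prime_iff_prime_int.1 hp).not_isUnit this

theorem DistinctModOn.injOn_cast (h : DistinctModOn n P y) :
    Set.InjOn (fun i => (y i : ZMod n)) P := fun i hi j hj hij =>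
  h i hi j hj ((ZMod.intCast_eq_intCast_iff _ _ _).1 hij)

theorem DistinctModOn.image_cast [NeZero n] (h : DistinctModOn n P y) (hP : P.card = n) :
    P.image (fun i => (y i : ZMod n)) = Finset.univ := by
  apply Finset.eq_univ_of_card
  rw [Finset.card_image_of_injOn h.injOn_cast, hP, ZMod.card]

theorem DistinctModOn.exists_modEq (h : DistinctModOn n P y) (hP : P.card = n) (hn : 0 < n)
    (r : ℤ) : ∃ i ∈ P, y i ≡ r [ZMOD n] := by
  have : NeZero n := ⟨hn.ne'⟩
  have : (r : ZMod n) ∈ P.image (fun i => (y i : ZMod n)) := by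
    rw [h.image_cast hP]; exact Finset.mem_univ _
  obtain ⟨i, hi, hr⟩ := Finset.mem_image.1 this
  exact ⟨i, hi, (ZMod.intCast_eq_intCast_iff _ _ _).1 hr⟩

/-- The sum of a complete system of residues modulo `n` is `n(n-1)/2`, up to a multiple of `n`. -/
theorem DistinctModOn.sum_modEq (h : DistinctModOn n P y) (hP : P.card = n) (hn : 0 < n) :
    ∑ i ∈ P, y i ≡ ∑ i ∈ Finset.range n, (i : ℤ) [ZMOD n] := by
  have : NeZero n := ⟨hn.ne'⟩
  have h2 : DistinctModOn n (Finset.range n) (fun i => (i : ℤ)) := by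
    intro i hi j hj hij
    exact Nat.ModEq.eq_of_lt_of_lt (Int.natCast_modEq_iff.1 hij) (Finset.mem_range.1 hi)
      (Finset.mem_range.1 hj)
  rw [← ZMod.intCast_eq_intCast_iff]
  push_cast
  have e1 := Finset.sum_image (f := fun r : ZMod n => r) h.injOn_cast
  have e2 := Finset.sum_image (f := fun r : ZMod n => r) h2.injOn_cast
  rw [h.image_cast hP] at e1
  rw [h2.image_cast (Finset.card_range n)] at e2
  rw [← e1, e2]
  simp

/-- The source of all labellings modulo `n`: a few labels are prescribed and the rest filled in
arbitrarily. -/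
theorem DistinctModOn.exists_extend [DecidableEq ι] (hP : P.card = n) (hn : 0 < n)
    (hf : DistinctModOn n W f) : ∃ y, DistinctModOn n P y ∧ ∀ i ∈ W, y i = f i := by
  have : NeZero n := ⟨hn.ne'⟩
  have hcard : Fintype.card P = (Finset.univ : Finset (ZMod n)).card := by
    simp [hP, ZMod.card]
  obtain ⟨g, hg⟩ := Finset.exists_equiv_extend_of_card_eq (α := P) (β := ZMod n) hcard
    (s := Finset.univ.filter (fun i : P => (i : ι) ∈ W)) (f := fun i => (f i : ZMod n))
    (by simp) (by
      intro i hi j hj hij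
      simp only [Finset.coe_filter, Finset.mem_univ, true_and, Set.mem_ofPred_eq] at hi hj
      exact Subtype.ext (hf.injOn_cast hi hj hij))
  refine ⟨fun i => if i ∈ W then f i else if h : i ∈ P then
    (((g ⟨i, h⟩ : (Finset.univ : Finset (ZMod n))) : ZMod n).val : ℤ) else 0, ?_, ?_⟩
  · have key : ∀ i (h : i ∈ P), (((if i ∈ W then f i else if h : i ∈ P then
        (((g ⟨i, h⟩ : (Finset.univ : Finset (ZMod n))) : ZMod n).val : ℤ) else 0 : ℤ)) : ZMod n)
        = (g ⟨i, h⟩ : (Finset.univ : Finset (ZMod n))) := by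
      intro i h
      by_cases hw : i ∈ W
      · rw [if_pos hw, hg ⟨i, h⟩ (by simpa using hw)]
      · rw [if_neg hw, dif_pos h]; simp
    intro i hi j hj hij
    have := (ZMod.intCast_eq_intCast_iff _ _ _).2 hij
    rw [key i hi, key j hj] at this
    have := g.injective (Subtype.ext this)
    exact congrArg Subtype.val this
  · intro i hi
    simp [hi]

theorem exists_distinctModOn [DecidableEq ι] (hP : P.card = n) (hn : 0 < n) :
    ∃ y, DistinctModOn n P y := by
  obtain ⟨y, hy, -⟩ := DistinctModOn.exists_extend (W := ∅) (f := 0) hP hn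
    (by intro i hi; simp at hi)
  exact ⟨y, hy⟩

/-- Splitting off the contribution of the deviations of `a` from a constant `c` at two indices. -/
theorem sum_modEq_of_pair [DecidableEq ι] {m : ℕ} {j k : ι} {c : ℤ} (hj : j ∈ P) (hk : k ∈ P)
    (hjk : j ≠ k) (hc : ∀ i ∈ P, i ≠ j → i ≠ k → a i ≡ c [ZMOD m]) (y : ι → ℤ) :
    ∑ i ∈ P, a i * y i ≡ c * ∑ i ∈ P, y i + (a j - c) * y j + (a k - c) * y k [ZMOD m] := by
  have hk' : k ∈ P.erase j := Finset.mem_erase.2 ⟨hjk.symm, hk⟩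
  rw [← Finset.add_sum_erase P _ hj, ← Finset.add_sum_erase _ _ hk',
    ← Finset.add_sum_erase P y hj, ← Finset.add_sum_erase _ y hk']
  have : ∑ i ∈ (P.erase j).erase k, a i * y i ≡ ∑ i ∈ (P.erase j).erase k, c * y i [ZMOD m] := by
    apply Int.ModEq.sum
    intro i hi
    simp only [Finset.mem_erase] at hi
    exact (hc i hi.2.2 hi.2.1 hi.1).mul_right _
  rw [← Finset.mul_sum] at this
  calc _ ≡ a j * y j + (a k * y k + c * ∑ i ∈ (P.erase j).erase k, y i) [ZMOD m] :=
        (this.add_left _).add_left _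
    _ = _ := by ring

theorem sum_modEq_of_single [DecidableEq ι] {m : ℕ} {b : ι} {c : ℤ} (hb : b ∈ P)
    (hc : ∀ i ∈ P, i ≠ b → a i ≡ c [ZMOD m]) (y : ι → ℤ) :
    ∑ i ∈ P, a i * y i ≡ c * ∑ i ∈ P, y i + (a b - c) * y b [ZMOD m] := by
  rw [← Finset.add_sum_erase P _ hb, ← Finset.add_sum_erase P y hb]
  have : ∑ i ∈ P.erase b, a i * y i ≡ ∑ i ∈ P.erase b, c * y i [ZMOD m] := by
    apply Int.ModEq.sum
    intro i hi
    simp only [Finset.mem_erase] at hi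
    exact (hc i hi.2 hi.1).mul_right _
  rw [← Finset.mul_sum] at this
  calc _ ≡ a b * y b + c * ∑ i ∈ P.erase b, y i [ZMOD m] := this.add_left _
    _ = _ := by ring

theorem sum_modEq_of_const {m : ℕ} {c : ℤ} (hc : ∀ i ∈ P, a i ≡ c [ZMOD m]) (y : ι → ℤ) :
    ∑ i ∈ P, a i * y i ≡ c * ∑ i ∈ P, y i [ZMOD m] := by
  rw [Finset.mul_sum]
  exact Int.ModEq.sum fun i hi => (hc i hi).mul_right _

/-- An integer combination of `d`, `e`, `n` without common prime factor hits every residue. -/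
theorem exists_mul_add_mul_modEq {d e : ℤ}
    (h : ∀ p : ℕ, p.Prime → p ∣ n → ¬ ((p : ℤ) ∣ d ∧ (p : ℤ) ∣ e)) (α : ℤ) :
    ∃ x y : ℤ, d * x + e * y ≡ α [ZMOD n] := by
  have hco : IsCoprime (gcd d e) (n : ℤ) := by
    rw [Int.isCoprime_iff_gcd_eq_one]
    by_contra hne
    obtain ⟨p, hp, hpd⟩ := Nat.exists_prime_and_dvd hne
    have h1 : (p : ℤ) ∣ gcd d e := (Int.natCast_dvd_natCast.2 hpd).trans (Int.gcd_dvd_left _ _)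
    have h2 : (p : ℤ) ∣ n := (Int.natCast_dvd_natCast.2 hpd).trans (Int.gcd_dvd_right _ _)
    exact h p hp (Int.natCast_dvd_natCast.1 h2)
      ⟨h1.trans (gcd_dvd_left _ _), h1.trans (gcd_dvd_right _ _)⟩
  obtain ⟨u, v, huv⟩ := hco
  have hg : gcd d e = d * Int.gcdA d e + e * Int.gcdB d e := Int.gcd_eq_gcd_ab d e
  refine ⟨Int.gcdA d e * u * α, Int.gcdB d e * u * α, ?_⟩
  rw [Int.modEq_iff_dvd]
  refine ⟨v * α, ?_⟩
  rw [hg] at huv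
  linear_combination (-α) * huv

theorem exists_mul_modEq_of_isCoprime {d : ℤ} {m : ℕ} (h : IsCoprime d (m : ℤ)) (α : ℤ) :
    ∃ x : ℤ, d * x ≡ α [ZMOD m] := by
  obtain ⟨u, v, huv⟩ := h
  refine ⟨u * α, ?_⟩
  rw [Int.modEq_iff_dvd]
  exact ⟨v * α, by linear_combination (-α) * huv⟩

theorem isCoprime_natPrime_iff {p : ℕ} (hp : p.Prime) (d : ℤ) :
    IsCoprime d (p : ℤ) ↔ ¬ d ≡ 0 [ZMOD p] := by
  rw [isCoprime_comm, (Nat.prime_iff_prime_int.1 hp).coprime_iff_not_dvd, Int.modEq_zero_iff_dvd]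

end Basic

/-! ### All but two coefficients agree -/

section PairType

variable {ι : Type*} [DecidableEq ι] {n : ℕ} {P : Finset ι} {a : ι → ℤ}

/-- With deviations d = a_j - c and e = a_k - c, the task is to solve dx + ey ≡ α - cK with x and y
incongruent. If a solution has x ≡ y, adding (e, -d) keeps it a solution and changes x - y by d + e,
which is nonzero by `hne`. -/
theorem solvableOn_of_pair_aux {j k : ι} {c : ℤ} (hP : P.card = n) (hj : j ∈ P) (hk : k ∈ P)
    (hjk : j ≠ k) (hc : ∀ i ∈ P, i ≠ j → i ≠ k → a i ≡ c [ZMOD n]) (hs : SpreadOn n P a)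
    (hne : ¬ (a j - c) + (a k - c) ≡ 0 [ZMOD n]) (α : ℤ) : SolvableOn n P a α := by
  have hn : 0 < n := hP ▸ Finset.card_pos.2 ⟨j, hj⟩
  set K : ℤ := ∑ i ∈ Finset.range n, (i : ℤ)
  have hpr : ∀ p : ℕ, p.Prime → p ∣ n → ¬ ((p : ℤ) ∣ a j - c ∧ (p : ℤ) ∣ a k - c) := by
    rintro p hp hd ⟨h1, h2⟩
    have : ∀ i ∈ P, a i ≡ c [ZMOD p] := by
      intro i hi
      by_cases hij : i = j
      · subst hij; exact (Int.modEq_iff_dvd.2 h1).symm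
      by_cases hik : i = k
      · subst hik; exact (Int.modEq_iff_dvd.2 h2).symm
      exact (hc i hi hij hik).of_dvd_nat hd
    exact hs p hp hd fun i hi i' hi' => (this i hi).trans (this i' hi').symm
  have : ∃ x y : ℤ, (a j - c) * x + (a k - c) * y ≡ α - c * K [ZMOD n] ∧ ¬ x ≡ y [ZMOD n] := by
    obtain ⟨x, y, hxy⟩ := exists_mul_add_mul_modEq hpr (α - c * K)
    by_cases h : x ≡ y [ZMOD n]
    · refine ⟨x + (a k - c), y - (a j - c), ?_, ?_⟩
      · convert hxy using 1; ring
      · intro h'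
        apply hne
        have := h'.sub h
        rw [Int.modEq_iff_dvd] at this ⊢
        convert this using 1; ring
    · exact ⟨x, y, hxy, h⟩
  obtain ⟨x, y, hxy, hd⟩ := this
  obtain ⟨z, hz, hzf⟩ := DistinctModOn.exists_extend (W := {j, k})
    (f := fun i => if i = j then x else y) hP hn
    (by
      intro i hi i' hi' h
      simp only [Finset.mem_insert, Finset.mem_singleton] at hi hi'
      rcases hi with rfl | rfl <;> rcases hi' with rfl | rfl
      · rfl
      · simp [hjk.symm] at h; exact absurd h hd
      · simp [hjk.symm] at h; exact absurd h.symm hd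
      · rfl)
  have hzj : z j = x := by simpa using hzf j (by simp)
  have hzk : z k = y := by simpa [hjk.symm] using hzf k (by simp)
  refine ⟨z, hz, (sum_modEq_of_pair hj hk hjk hc z).trans ?_⟩
  rw [hzj, hzk]
  have h1 := ((hz.sum_modEq hP hn).mul_left c).add hxy
  convert h1 using 1 <;> ring

/-- Coprimality is automatic: a prime dividing n and a_j - a_l would also divide a_k - a_l, making
all coefficients congruent. -/
theorem exceptionalOn_of_pair {j k l : ι} (hj : j ∈ P) (hk : k ∈ P) (hl : l ∈ P)
    (hjk : j ≠ k) (hjl : j ≠ l) (hkl : k ≠ l)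
    (hc : ∀ i ∈ P, i ≠ j → i ≠ k → a i ≡ a l [ZMOD n]) (hs : SpreadOn n P a)
    (he : a j + a k ≡ 2 * a l [ZMOD n]) : ExceptionalOn n P a := by
  refine ⟨j, hj, k, hk, l, hl, hjk, hjl, hkl, he, ?_, hc⟩
  rw [Int.isCoprime_iff_gcd_eq_one]
  by_contra hne
  obtain ⟨p, hp, hpd⟩ := Nat.exists_prime_and_dvd hne
  have h1 : (p : ℤ) ∣ a j - a l := (Int.natCast_dvd_natCast.2 hpd).trans (Int.gcd_dvd_left _ _)
  have h2 : p ∣ n := Int.natCast_dvd_natCast.1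
    ((Int.natCast_dvd_natCast.2 hpd).trans (Int.gcd_dvd_right _ _))
  have hjl' : a j ≡ a l [ZMOD p] := (Int.modEq_iff_dvd.2 h1).symm
  have : ∀ i ∈ P, a i ≡ a l [ZMOD p] := by
    intro i hi
    by_cases hij : i = j
    · subst hij; exact hjl'
    by_cases hik : i = k
    · subst hik
      have := (he.of_dvd_nat h2).sub hjl'
      convert this using 1 <;> ring
    exact (hc i hi hij hik).of_dvd_nat h2
  exact hs p hp h2 fun i hi i' hi' => (this i hi).trans (this i' hi').symm

/-- The main theorem when all but two coefficients agree. -/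
theorem solvableOn_of_pair {j k : ι} {c : ℤ} (hP : P.card = n) (hj : j ∈ P) (hk : k ∈ P)
    (hjk : j ≠ k) (hc : ∀ i ∈ P, i ≠ j → i ≠ k → a i ≡ c [ZMOD n]) (hs : SpreadOn n P a)
    (hex : ¬ ExceptionalOn n P a) (α : ℤ) : SolvableOn n P a α := by
  by_cases h : ∃ l ∈ P, l ≠ j ∧ l ≠ k
  · obtain ⟨l, hl, hlj, hlk⟩ := h
    have hlc := hc l hl hlj hlk
    apply solvableOn_of_pair_aux hP hj hk hjk hc hs
    intro h0
    apply hex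
    refine exceptionalOn_of_pair hj hk hl hjk hlj.symm hlk.symm
      (fun i hi h1 h2 => (hc i hi h1 h2).trans hlc.symm) hs ?_
    have := (h0.add_right (2 * c)).trans ((hlc.mul_left 2).symm.add_left 0)
    convert this using 1 <;> ring
  · push Not at h
    have hPeq : P = {j, k} := by
      ext i
      simp only [Finset.mem_insert, Finset.mem_singleton]
      constructor
      · intro hi
        by_cases hij : i = j
        · exact Or.inl hij
        · exact Or.inr (h i hi hij)
      · rintro (rfl | rfl) <;> assumption
    have hn2 : n = 2 := by rw [← hP, hPeq, Finset.card_pair hjk]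
    -- Without a third index any centre is allowed; centring at a_j leaves the single deviation a_k
    -- - a_j, which is odd by spreadness.
    refine solvableOn_of_pair_aux (c := a j) hP hj hk hjk
      (fun i hi h1 h2 => absurd (h i hi h1) h2) hs ?_ α
    intro h0
    refine hs 2 Nat.prime_two (by rw [hn2]) ?_
    have h0' : a k ≡ a j [ZMOD (2 : ℕ)] := by
      have := h0.add_right (a j)
      rw [hn2] at this
      simpa using this
    intro i hi i' hi'
    rw [hPeq] at hi hi'
    simp only [Finset.mem_insert, Finset.mem_singleton] at hi hi'
    rcases hi with rfl | rfl <;> rcases hi' with rfl | rfl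
    exacts [rfl, h0'.symm, h0', rfl]

/-- The two deviations cancel, leaving n copies of a_l. This invariant later shows that replacing
one coefficient by an incongruent one destroys exceptionality. -/
theorem ExceptionalOn.sum_modEq_zero (hP : P.card = n) (h : ExceptionalOn n P a) :
    ∑ i ∈ P, a i ≡ 0 [ZMOD n] := by
  obtain ⟨j, hj, k, hk, l, hl, hjk, hjl, hkl, he, -, hc⟩ := h
  have := sum_modEq_of_pair hj hk hjk hc (fun _ => 1)
  simp only [mul_one, Finset.sum_const, hP, nsmul_eq_mul] at this
  refine this.trans ?_
  have h2 := he.sub_right (2 * a l)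
  rw [Int.modEq_iff_dvd] at h2 ⊢
  obtain ⟨t, ht⟩ := h2
  exact ⟨t - a l, by linear_combination ht⟩

theorem ExceptionalOn.three_le (hP : P.card = n) (h : ExceptionalOn n P a) : 3 ≤ n := by
  obtain ⟨j, hj, k, hk, l, hl, hjk, hjl, hkl, -⟩ := h
  rw [← hP, ← Finset.card_eq_three.2 ⟨j, k, l, hjk, hjl, hkl, rfl⟩]
  apply Finset.card_le_card
  intro i hi
  simp only [Finset.mem_insert, Finset.mem_singleton] at hi
  rcases hi with rfl | rfl | rfl <;> assumption

/-- The opposite deviations turn the sum into a_l K + (a_j - a_l)(z_j - z_k). The first factor is a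
unit and the second ranges over exactly the nonzero residues. -/
theorem ExceptionalOn.solvableOn_iff (hP : P.card = n) {j k l : ι} (hj : j ∈ P) (hk : k ∈ P)
    (hjk : j ≠ k) (he : a j + a k ≡ 2 * a l [ZMOD n]) (hco : IsCoprime (a j - a l) (n : ℤ))
    (hc : ∀ i ∈ P, i ≠ j → i ≠ k → a i ≡ a l [ZMOD n]) (α : ℤ) :
    SolvableOn n P a α ↔ ¬ α ≡ a l * ∑ i ∈ Finset.range n, (i : ℤ) [ZMOD n] := by
  have hn : 0 < n := hP ▸ Finset.card_pos.2 ⟨j, hj⟩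
  set K : ℤ := ∑ i ∈ Finset.range n, (i : ℤ)
  have key : ∀ z, DistinctModOn n P z →
      ∑ i ∈ P, a i * z i ≡ a l * K + (a j - a l) * (z j - z k) [ZMOD n] := by
    intro z hz
    refine (sum_modEq_of_pair hj hk hjk hc z).trans ?_
    have h1 := (hz.sum_modEq hP hn).mul_left (a l)
    have h2 : (a k - a l) * z k ≡ (a l - a j) * z k [ZMOD n] := by
      apply Int.ModEq.mul_right
      have := he.sub_right (a l + a j)
      rw [show a k - a l = a j + a k - (a l + a j) by ring,
        show a l - a j = 2 * a l - (a l + a j) by ring]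
      exact this
    have := (h1.add_right ((a j - a l) * z j)).add h2
    convert this using 1; ring
  constructor
  · rintro ⟨z, hz, hza⟩ h
    have h1 := ((key z hz).symm.trans hza).trans h
    have h2 : (n : ℤ) ∣ (a j - a l) * (z j - z k) := by
      rw [Int.modEq_iff_dvd] at h1
      obtain ⟨t, ht⟩ := h1
      exact ⟨-t, by linear_combination -ht⟩
    have h3 := hco.symm.dvd_of_dvd_mul_left h2
    exact hjk (hz j hj k hk (Int.modEq_iff_dvd.2 h3).symm)
  · intro h
    obtain ⟨x, hx⟩ := exists_mul_modEq_of_isCoprime hco (α - a l * K)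
    have hx0 : ¬ x ≡ 0 [ZMOD n] := by
      intro h0
      apply h
      have := (h0.mul_left (a j - a l)).symm.trans hx
      have := this.add_right (a l * K)
      rw [mul_zero] at this
      exact (by simpa using this.symm : α ≡ a l * K [ZMOD n])
    obtain ⟨z, hz, hzf⟩ := DistinctModOn.exists_extend (W := {j, k})
      (f := fun i => if i = j then x else 0) hP hn
      (by
        intro i hi i' hi' h
        simp only [Finset.mem_insert, Finset.mem_singleton] at hi hi'
        rcases hi with rfl | rfl <;> rcases hi' with rfl | rfl
        · rfl
        · simp [hjk.symm] at h; exact absurd h hx0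
        · simp [hjk.symm] at h; exact absurd h.symm hx0
        · rfl)
    have hzj : z j = x := by simpa using hzf j (by simp)
    have hzk : z k = 0 := by simpa [hjk.symm] using hzf k (by simp)
    refine ⟨z, hz, (key z hz).trans ?_⟩
    rw [hzj, hzk]
    have := hx.add_left (a l * K)
    convert this using 1 <;> ring

/-- Exceptional coefficients miss only one residue. -/
theorem ExceptionalOn.solvableOn_or (hP : P.card = n) (h : ExceptionalOn n P a) {α β : ℤ}
    (hαβ : ¬ α ≡ β [ZMOD n]) : SolvableOn n P a α ∨ SolvableOn n P a β := by
  obtain ⟨j, hj, k, hk, l, hl, hjk, hjl, hkl, he, hco, hc⟩ := h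
  rw [ExceptionalOn.solvableOn_iff hP hj hk hjk he hco hc,
    ExceptionalOn.solvableOn_iff hP hj hk hjk he hco hc]
  by_contra! hh
  exact hαβ (hh.1.trans hh.2.symm)

end PairType

open scoped Pointwise

/-! ### Counting weighted sums modulo a prime -/

section LabelSums

open Classical in
/-- The residues `∑ a i * z i` over `Q`, where `z` runs over the bijections of `Q` with
`{0, …, |Q| - 1}`. -/
noncomputable def labelSums {ι : Type*} (p : ℕ) [NeZero p] (Q : Finset ι) (a : ι → ZMod p) :
    Finset (ZMod p) :=
  Finset.univ.filter fun v => ∃ z : ι → ℕ, Set.InjOn z Q ∧ (∀ i ∈ Q, z i < Q.card) ∧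
    ∑ i ∈ Q, a i * z i = v

variable {ι : Type*} {p : ℕ} {Q W T : Finset ι}

theorem natCast_ne_zero_of_lt {p t : ℕ} (h0 : 0 < t) (hlt : t < p) : (t : ZMod p) ≠ 0 := by
  rw [Ne, ZMod.natCast_eq_zero_iff]
  exact fun h => absurd (Nat.le_of_dvd h0 h) (by omega)

theorem mem_labelSums [NeZero p] {a : ι → ZMod p} {v : ZMod p} :
    v ∈ labelSums p Q a ↔ ∃ z : ι → ℕ, Set.InjOn z Q ∧
    (∀ i ∈ Q, z i < Q.card) ∧ ∑ i ∈ Q, a i * z i = v := by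
  simp [labelSums]

theorem sum_label {z : ι → ℕ} (hz : Set.InjOn z Q) (hlt : ∀ i ∈ Q, z i < Q.card) :
    ∑ i ∈ Q, z i = ∑ i ∈ Finset.range Q.card, i := by
  have : Q.image z = Finset.range Q.card := by
    apply Finset.eq_of_subset_of_card_le
    · intro v hv
      obtain ⟨i, hi, rfl⟩ := Finset.mem_image.1 hv
      exact Finset.mem_range.2 (hlt i hi)
    · rw [Finset.card_image_of_injOn hz, Finset.card_range]
  rw [← this, Finset.sum_image hz]

variable [DecidableEq ι]

theorem exists_label_extend {f : ι → ℕ} (hWQ : W ⊆ Q) (hf : Set.InjOn f W)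
    (hlt : ∀ i ∈ W, f i < Q.card) :
    ∃ z : ι → ℕ, Set.InjOn z Q ∧ (∀ i ∈ Q, z i < Q.card) ∧ ∀ i ∈ W, z i = f i := by
  obtain ⟨g, hg⟩ := Finset.exists_equiv_extend_of_card_eq (α := Q) (β := ℕ)
    (t := Finset.range Q.card) (by simp)
    (s := Finset.univ.filter (fun i : Q => (i : ι) ∈ W)) (f := fun i => f i)
    (by
      intro v hv
      simp only [Finset.mem_image, Finset.mem_filter, Finset.mem_univ, true_and] at hv
      obtain ⟨i, hi, rfl⟩ := hv
      exact Finset.mem_range.2 (hlt i hi))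
    (by
      intro i hi j hj hij
      simp only [Finset.coe_filter, Finset.mem_univ, true_and, Set.mem_ofPred_eq] at hi hj
      exact Subtype.ext (hf hi hj hij))
  have key : ∀ i (h : i ∈ Q), (if h : i ∈ Q then (g ⟨i, h⟩ : ℕ) else 0) = g ⟨i, h⟩ :=
    fun i h => dif_pos h
  refine ⟨fun i => if h : i ∈ Q then (g ⟨i, h⟩ : ℕ) else 0, ?_, ?_, ?_⟩
  · intro i hi j hj hij
    have hij' : (g ⟨i, hi⟩ : ℕ) = g ⟨j, hj⟩ := by
      rw [← key i hi, ← key j hj]; exact hij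
    exact congrArg Subtype.val (g.injective (Subtype.ext hij'))
  · intro i hi
    simp only [key i hi]
    exact Finset.mem_range.1 (g ⟨i, hi⟩).2
  · intro i hi
    simp only [key i (hWQ hi)]
    exact hg ⟨i, hWQ hi⟩ (by simpa using hi)

variable [NeZero p] {a : ι → ZMod p}

theorem labelSums_nonempty : (labelSums p Q a).Nonempty := by
  obtain ⟨z, h1, h2, -⟩ := exists_label_extend (W := ∅) (Q := Q) (f := 0) (by simp) (by simp)
    (by simp)
  exact ⟨_, mem_labelSums.2 ⟨z, h1, h2, rfl⟩⟩

/-- Shifting the labels of `Q \ T` up by |T| makes them disjoint from those of `T` and only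
translates their sums. So the sumset of the two families embeds in that of `Q`, and Cauchy-Davenport
applies. -/
theorem min_le_card_labelSums (hp : p.Prime) (hT : T ⊆ Q) :
    min p ((labelSums p T a).card + (labelSums p (Q \ T) a).card - 1) ≤
      (labelSums p Q a).card := by
  refine (ZMod.cauchy_davenport hp labelSums_nonempty labelSums_nonempty).trans ?_
  rw [← Finset.card_image_of_injective _
    (add_left_injective (∑ i ∈ Q \ T, a i * (T.card : ZMod p)))]
  apply Finset.card_le_card
  intro v hv
  obtain ⟨w, hw, rfl⟩ := Finset.mem_image.1 hv
  obtain ⟨w1, hw1, w2, hw2, rfl⟩ := Finset.mem_add.1 hw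
  obtain ⟨z1, i1, l1, rfl⟩ := mem_labelSums.1 hw1
  obtain ⟨z2, i2, l2, rfl⟩ := mem_labelSums.1 hw2
  have hcard : (Q \ T).card + T.card = Q.card := Finset.card_sdiff_add_card_eq_card hT
  refine mem_labelSums.2 ⟨fun i => if i ∈ T then z1 i else z2 i + T.card, ?_, ?_, ?_⟩
  · intro i hi j hj hij
    simp only at hij
    by_cases h1 : i ∈ T <;> by_cases h2 : j ∈ T
    · rw [if_pos h1, if_pos h2] at hij
      exact i1 h1 h2 hij
    · rw [if_pos h1, if_neg h2] at hij
      have := l1 i h1; omega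
    · rw [if_neg h1, if_pos h2] at hij
      have := l1 j h2; omega
    · rw [if_neg h1, if_neg h2] at hij
      exact i2 (by simpa [h1] using hi) (by simpa [h2] using hj) (by omega)
  · intro i hi
    by_cases h1 : i ∈ T
    · have := l1 i h1; simp only [if_pos h1]; omega
    · have := l2 i (Finset.mem_sdiff.2 ⟨hi, h1⟩); simp only [if_neg h1]; omega
  · have h1 : ∑ i ∈ Q \ T, a i * ((if i ∈ T then z1 i else z2 i + T.card : ℕ) : ZMod p) =
        ∑ i ∈ Q \ T, a i * (z2 i : ZMod p) + ∑ i ∈ Q \ T, a i * (T.card : ZMod p) := by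
      rw [← Finset.sum_add_distrib]
      refine Finset.sum_congr rfl fun i hi => ?_
      rw [if_neg (Finset.mem_sdiff.1 hi).2]; push_cast; ring
    have h2 : ∑ i ∈ T, a i * ((if i ∈ T then z1 i else z2 i + T.card : ℕ) : ZMod p) =
        ∑ i ∈ T, a i * (z1 i : ZMod p) :=
      Finset.sum_congr rfl fun i hi => by rw [if_pos hi]
    rw [← Finset.sum_sdiff hT, h1, h2]
    ring

theorem pair_mem_labelSums {j k : ι} {c : ZMod p} (hj : j ∈ Q) (hk : k ∈ Q) (hjk : j ≠ k)
    (hc : ∀ i ∈ Q, i ≠ j → i ≠ k → a i = c) {x y : ℕ} (hx : x < Q.card) (hy : y < Q.card)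
    (hxy : x ≠ y) :
    c * (∑ i ∈ Finset.range Q.card, i : ℕ) + ((a j - c) * x + (a k - c) * y) ∈
      labelSums p Q a := by
  obtain ⟨z, h1, h2, h3⟩ := exists_label_extend (W := {j, k}) (Q := Q)
    (f := fun i => if i = j then x else y)
    (by intro i hi; simp at hi; rcases hi with rfl | rfl <;> assumption)
    (by
      intro i hi i' hi' h
      simp only [Finset.coe_insert, Finset.coe_singleton, Set.mem_insert_iff,
        Set.mem_singleton_iff] at hi hi'
      rcases hi with rfl | rfl <;> rcases hi' with rfl | rfl
      · rfl
      · simp [hjk.symm] at h; exact absurd h hxy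
      · simp [hjk.symm] at h; exact absurd h.symm hxy
      · rfl)
    (by
      intro i _
      by_cases h : i = j
      · simpa [h] using hx
      · simpa [h] using hy)
  have hzj : z j = x := by simpa using h3 j (by simp)
  have hzk : z k = y := by simpa [hjk.symm] using h3 k (by simp)
  refine mem_labelSums.2 ⟨z, h1, h2, ?_⟩
  rw [← sum_label h1 h2]
  have hk' : k ∈ Q.erase j := Finset.mem_erase.2 ⟨hjk.symm, hk⟩
  rw [← Finset.add_sum_erase Q _ hj, ← Finset.add_sum_erase _ _ hk',
    ← Finset.add_sum_erase Q z hj, ← Finset.add_sum_erase _ z hk', hzj, hzk,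
    Finset.sum_congr (s₁ := (Q.erase j).erase k) (g := fun i => c * (z i : ZMod p)) rfl
      (fun i hi => by
        simp only [Finset.mem_erase] at hi
        rw [hc i hi.2.2 hi.2.1 hi.1]), ← Finset.mul_sum]
  push_cast
  ring

theorem card_labelSums_of_single {j : ι} {c : ZMod p} (hp : p.Prime) (hj : j ∈ Q)
    (hcard : Q.card ≤ p) (hQ : 2 ≤ Q.card)
    (hc : ∀ i ∈ Q, i ≠ j → a i = c) (hne : a j ≠ c) : Q.card ≤ (labelSums p Q a).card := by
  have : Fact p.Prime := ⟨hp⟩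
  obtain ⟨k, hk, hkj⟩ := Finset.exists_mem_ne (by omega : 1 < Q.card) j
  have hkc := hc k hk hkj
  have hd : a j - c ≠ 0 := sub_ne_zero.2 hne
  have hinj : Set.InjOn (fun x : ℕ => c * ((∑ i ∈ Finset.range Q.card, i : ℕ) : ZMod p) +
      (a j - c) * x) (Finset.range Q.card) := by
    intro x hx y hy hxy
    have h1 := mul_left_cancel₀ hd (add_left_cancel hxy)
    rw [ZMod.natCast_eq_natCast_iff] at h1
    simp only [Finset.coe_range, Set.mem_Iio] at hx hy
    exact Nat.ModEq.eq_of_lt_of_lt h1 (by omega) (by omega)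
  conv_lhs => rw [← Finset.card_range Q.card, ← Finset.card_image_of_injOn hinj]
  apply Finset.card_le_card
  intro v hv
  obtain ⟨x, hx, rfl⟩ := Finset.mem_image.1 hv
  have hx' := Finset.mem_range.1 hx
  -- The second index has zero deviation, so its label need only differ from `x`.
  have := pair_mem_labelSums (a := a) hj hk hkj.symm (fun i hi h _ => hc i hi h) hx'
    (y := if x = 0 then 1 else 0) (by split_ifs <;> omega) (by split_ifs <;> omega)
  rw [hkc] at this
  simpa using this

/-- After scaling the deviation of k to 1 and that of j to β, the labels x = 0, y = 1, …, m - 1 give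
m - 1 values in progression, and some βx + y falls outside them. -/
theorem card_labelSums_of_pair {j k : ι} {c : ZMod p} (hp : p.Prime) (hj : j ∈ Q) (hk : k ∈ Q)
    (hjk : j ≠ k) (hcard : Q.card < p) (hQ : 3 ≤ Q.card)
    (hc : ∀ i ∈ Q, i ≠ j → i ≠ k → a i = c) (hjc : a j ≠ c) (hkc : a k ≠ c) :
    Q.card ≤ (labelSums p Q a).card := by
  have : Fact p.Prime := ⟨hp⟩
  set m := Q.card with hm
  set K : ZMod p := c * ((∑ i ∈ Finset.range m, i : ℕ) : ZMod p) with hK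
  have hd : a j - c ≠ 0 := sub_ne_zero.2 hjc
  have he : a k - c ≠ 0 := sub_ne_zero.2 hkc
  have hmem : ∀ x y : ℕ, x < m → y < m → x ≠ y →
      K + ((a j - c) * x + (a k - c) * y) ∈ labelSums p Q a :=
    fun x y hx hy hxy => pair_mem_labelSums hj hk hjk hc hx hy hxy
  have hinj : Function.Injective fun v : ZMod p => K + (a k - c) * v := fun u v h =>
    mul_left_cancel₀ he (add_left_cancel h)
  obtain ⟨β, hβ⟩ : ∃ β : ZMod p, a j - c = (a k - c) * β :=
    ⟨(a k - c)⁻¹ * (a j - c), by rw [mul_inv_cancel_left₀ he]⟩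
  have hmem' : ∀ x y : ℕ, x < m → y < m → x ≠ y →
      K + (a k - c) * (β * x + y) ∈ labelSums p Q a := by
    intro x y hx hy hxy
    have := hmem x y hx hy hxy
    rw [hβ] at this
    convert this using 1; ring
  -- one value outside the progression `1, …, m - 1`
  set S : Finset (ZMod p) := (Finset.Ico 1 m).image (fun x : ℕ => (x : ZMod p)) with hS
  have hScard : S.card = m - 1 := by
    rw [hS, Finset.card_image_of_injOn, Nat.card_Ico]
    intro x hx y hy hxy
    simp only [Finset.coe_Ico, Set.mem_Ico] at hx hy
    rw [ZMod.natCast_eq_natCast_iff] at hxy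
    exact Nat.ModEq.eq_of_lt_of_lt hxy (by omega) (by omega)
  have hnot : ∀ t : ℕ, m ≤ t → t ≤ p → (t : ZMod p) ∉ S := by
    intro t h1 h2 h
    obtain ⟨x, hx, hxt⟩ := Finset.mem_image.1 h
    rw [Finset.mem_Ico] at hx
    rw [ZMod.natCast_eq_natCast_iff] at hxt
    rcases h2.eq_or_lt with rfl | h2
    · have := (Nat.modEq_zero_iff_dvd.1 (hxt.trans (by simp [Nat.ModEq])))
      exact absurd (Nat.le_of_dvd (by omega) this) (by omega)
    · have := Nat.ModEq.eq_of_lt_of_lt hxt (by omega) h2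
      omega
  obtain ⟨x, y, hx, hy, hxy, hout⟩ : ∃ x y : ℕ, x < m ∧ y < m ∧ x ≠ y ∧ β * x + y ∉ S := by
    by_cases h : β ∈ S
    · obtain ⟨s, hs, rfl⟩ := Finset.mem_image.1 h
      rw [Finset.mem_Ico] at hs
      -- The natural choice is to reach s + (m - s) = m, just past the progression. For s = m - 1 it
      -- would give both indices the label 1, so m + 1 ≤ p is used instead.
      by_cases hs' : s = m - 1
      · refine ⟨1, 2, by omega, by omega, by omega, ?_⟩
        have := hnot (s + 2) (by omega) (by omega)
        simpa using this
      · refine ⟨1, m - s, by omega, by omega, by omega, ?_⟩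
        have := hnot (s + (m - s)) (by omega) (by omega)
        push_cast at this
        simpa using this
    · exact ⟨1, 0, by omega, by omega, by omega, by simpa using h⟩
  have hcard' : (insert (β * x + y) S).card = m := by
    rw [Finset.card_insert_of_notMem hout, hScard]; omega
  rw [← hcard', ← Finset.card_image_of_injective _ hinj]
  apply Finset.card_le_card
  intro v hv
  obtain ⟨w, hw, rfl⟩ := Finset.mem_image.1 hv
  rcases Finset.mem_insert.1 hw with rfl | hw
  · exact hmem' x y hx hy hxy
  · obtain ⟨t, ht, rfl⟩ := Finset.mem_image.1 hw
    rw [Finset.mem_Ico] at ht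
    have := hmem' 0 t (by omega) ht.2 (by omega)
    simpa using this

theorem four_le_card_labelSums {i j k : ι} (hp : p.Prime) (hp5 : 5 ≤ p) (hij : a i ≠ a j)
    (hik : a i ≠ a k) (hjk : a j ≠ a k) : 4 ≤ (labelSums p {i, j, k} a).card := by
  have : Fact p.Prime := ⟨hp⟩
  have ij : i ≠ j := fun h => hij (h ▸ rfl)
  have ik : i ≠ k := fun h => hik (h ▸ rfl)
  have jk : j ≠ k := fun h => hjk (h ▸ rfl)
  have hcard : ({i, j, k} : Finset ι).card = 3 := Finset.card_eq_three.2 ⟨i, j, k, ij, ik, jk, rfl⟩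
  have hmem : ∀ x y : ℕ, x < 3 → y < 3 → x ≠ y →
      a i * 3 + ((a j - a i) * x + (a k - a i) * y) ∈ labelSums p {i, j, k} a := by
    intro x y hx hy hxy
    have := pair_mem_labelSums (a := a) (Q := {i, j, k}) (c := a i) (by simp) (by simp) jk
      (by
        intro t ht h1 h2
        simp only [Finset.mem_insert, Finset.mem_singleton] at ht
        rcases ht with rfl | rfl | rfl <;> simp_all) (x := x) (y := y) (by omega) (by omega) hxy
    rw [hcard] at this
    simpa [Finset.sum_range_succ] using this
  have h2 : (2 : ZMod p) ≠ 0 := by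
    exact_mod_cast natCast_ne_zero_of_lt (p := p) (t := 2) (by omega) (by omega)
  have h3 : (3 : ZMod p) ≠ 0 := by
    exact_mod_cast natCast_ne_zero_of_lt (p := p) (t := 3) (by omega) (by omega)
  have h4 : (4 : ZMod p) ≠ 0 := by
    exact_mod_cast natCast_ne_zero_of_lt (p := p) (t := 4) (by omega) (by omega)
  obtain ⟨b, hb⟩ : ∃ b, b = a j - a i := ⟨_, rfl⟩
  obtain ⟨c, hc⟩ : ∃ c, c = a k - a i := ⟨_, rfl⟩
  have hb0 : b ≠ 0 := by rw [hb]; exact sub_ne_zero.2 hij.symm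
  have hc0 : c ≠ 0 := by rw [hc]; exact sub_ne_zero.2 hik.symm
  have hbc : b ≠ c := by rw [hb, hc]; exact fun h => hjk (sub_left_injective h)
  rw [← hb, ← hc] at hmem
  have main : ∀ w₁ w₂ w₃ w₄ : ZMod p, w₁ ≠ w₂ → w₁ ≠ w₃ → w₁ ≠ w₄ → w₂ ≠ w₃ → w₂ ≠ w₄ → w₃ ≠ w₄ →
      (∀ w ∈ ({w₁, w₂, w₃, w₄} : Finset (ZMod p)), a i * 3 + w ∈ labelSums p {i, j, k} a) →
      4 ≤ (labelSums p {i, j, k} a).card := by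
    intro w₁ w₂ w₃ w₄ h12 h13 h14 h23 h24 h34 hw
    have hc4 : ({w₁, w₂, w₃, w₄} : Finset (ZMod p)).card = 4 := by
      rw [Finset.card_insert_of_notMem (by simp [*]), Finset.card_insert_of_notMem (by simp [*]),
        Finset.card_pair h34]
    rw [← hc4, ← Finset.card_image_of_injective _ (add_right_injective (a i * 3))]
    apply Finset.card_le_card
    intro v hv
    obtain ⟨w, hw', rfl⟩ := Finset.mem_image.1 hv
    exact hw w hw'
  have e10 := hmem 1 0 (by omega) (by omega) (by omega)
  have e20 := hmem 2 0 (by omega) (by omega) (by omega)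
  have e01 := hmem 0 1 (by omega) (by omega) (by omega)
  have e02 := hmem 0 2 (by omega) (by omega) (by omega)
  have e12 := hmem 1 2 (by omega) (by omega) (by omega)
  have e21 := hmem 2 1 (by omega) (by omega) (by omega)
  have nz : ∀ t s : ZMod p, t ≠ 0 → s ≠ 0 → t * s ≠ 0 := fun t s => mul_ne_zero
  -- The values b, 2b, c, 2c are distinct unless one of b, c is twice the other; then the multiples
  -- 1, 2, 4, 5 of the smaller generator serve, and are distinct since p ≥ 5.
  by_cases hcase : c = b * 2
  · subst hcase
    refine main b (b * 2) (b * 4) (b * 5) ?_ ?_ ?_ ?_ ?_ ?_ ?_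
    · exact fun h => hb0 (by linear_combination -h)
    · exact fun h => nz _ _ h3 hb0 (by linear_combination -h)
    · exact fun h => nz _ _ h4 hb0 (by linear_combination -h)
    · exact fun h => nz _ _ h2 hb0 (by linear_combination -h)
    · exact fun h => nz _ _ h3 hb0 (by linear_combination -h)
    · exact fun h => hb0 (by linear_combination -h)
    · intro w hw
      simp only [Finset.mem_insert, Finset.mem_singleton] at hw
      rcases hw with rfl | rfl | rfl | rfl
      · convert e10 using 1; push_cast; ring
      · convert e20 using 1; push_cast; ring
      · convert e02 using 1; push_cast; ring
      · convert e12 using 1; push_cast; ring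
  by_cases hcase' : b = c * 2
  · subst hcase'
    refine main c (c * 2) (c * 4) (c * 5) ?_ ?_ ?_ ?_ ?_ ?_ ?_
    · exact fun h => hc0 (by linear_combination -h)
    · exact fun h => nz _ _ h3 hc0 (by linear_combination -h)
    · exact fun h => nz _ _ h4 hc0 (by linear_combination -h)
    · exact fun h => nz _ _ h2 hc0 (by linear_combination -h)
    · exact fun h => nz _ _ h3 hc0 (by linear_combination -h)
    · exact fun h => hc0 (by linear_combination -h)
    · intro w hw
      simp only [Finset.mem_insert, Finset.mem_singleton] at hw
      rcases hw with rfl | rfl | rfl | rfl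
      · convert e01 using 1; push_cast; ring
      · convert e02 using 1; push_cast; ring
      · convert e20 using 1; push_cast; ring
      · convert e21 using 1; push_cast; ring
  refine main b (b * 2) c (c * 2) ?_ hbc hcase' (fun h => hcase h.symm) ?_ ?_ ?_
  · exact fun h => hb0 (by linear_combination -h)
  · exact fun h => hbc (mul_right_cancel₀ h2 h)
  · exact fun h => hc0 (by linear_combination -h)
  · intro w hw
    simp only [Finset.mem_insert, Finset.mem_singleton] at hw
    rcases hw with rfl | rfl | rfl | rfl
    · convert e10 using 1; push_cast; ring
    · convert e20 using 1; push_cast; ring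
    · convert e01 using 1; push_cast; ring
    · convert e02 using 1; push_cast; ring

/-- The sum depends only on x + y, where x ≠ y are the labels in 0, …, 3 of the pair k, l; this
takes the values 1, …, 5, distinct modulo p ≥ 5. -/
theorem five_le_card_labelSums {i j k l : ι} (hp : p.Prime) (hp5 : 5 ≤ p) (ij : i ≠ j)
    (kl : k ≠ l) (hij : a i = a j) (hkl : a k = a l) (hik : a i ≠ a k) :
    5 ≤ (labelSums p {i, j, k, l} a).card := by
  have : Fact p.Prime := ⟨hp⟩
  have ik : i ≠ k := fun h => hik (h ▸ rfl)
  have il : i ≠ l := fun h => hik (by rw [h, hkl])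
  have jk : j ≠ k := fun h => hik (by rw [hij, h])
  have jl : j ≠ l := fun h => hik (by rw [hij, h, hkl])
  have hcard : ({i, j, k, l} : Finset ι).card = 4 := by
    rw [Finset.card_insert_of_notMem (by simp [*]), Finset.card_insert_of_notMem (by simp [*]),
      Finset.card_pair kl]
  have hmem : ∀ x y : ℕ, x < 4 → y < 4 → x ≠ y →
      a i * 6 + (a k - a i) * ((x + y : ℕ) : ZMod p) ∈ labelSums p {i, j, k, l} a := by
    intro x y hx hy hxy
    have := pair_mem_labelSums (a := a) (Q := {i, j, k, l}) (c := a i) (j := k) (k := l) (by simp)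
      (by simp) kl
      (by
        intro t ht h1 h2
        simp only [Finset.mem_insert, Finset.mem_singleton] at ht
        rcases ht with rfl | rfl | rfl | rfl <;> simp_all) (x := x) (y := y) (by omega) (by omega) hxy
    rw [hcard, ← hkl] at this
    simp only [Finset.sum_range_succ, Finset.sum_range_zero] at this
    convert this using 1; push_cast; ring
  have hd : a k - a i ≠ 0 := sub_ne_zero.2 hik.symm
  have hinj : Set.InjOn (fun x : ℕ => a i * 6 + (a k - a i) * (x : ZMod p)) (Finset.Ico 1 6) := by
    intro x hx y hy hxy
    have h1 := mul_left_cancel₀ hd (add_left_cancel hxy)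
    simp only [Finset.coe_Ico, Set.mem_Ico] at hx hy
    by_contra hne
    have key : ∀ x y : ℕ, 1 ≤ x → y < 6 → x < y → (x : ZMod p) = y → False := by
      intro x y hx hy hxy h
      have : ((y - x : ℕ) : ZMod p) = 0 := by rw [Nat.cast_sub hxy.le, h, sub_self]
      exact natCast_ne_zero_of_lt (by omega) (by omega) this
    rcases Nat.lt_or_gt_of_ne hne with h | h
    · exact key x y hx.1 hy.2 h h1
    · exact key y x hy.1 hx.2 h h1.symm
  have : (Finset.Ico 1 6).card = 5 := by simp
  rw [← this, ← Finset.card_image_of_injOn hinj]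
  apply Finset.card_le_card
  intro v hv
  obtain ⟨x, hx, rfl⟩ := Finset.mem_image.1 hv
  rw [Finset.mem_Ico] at hx
  obtain ⟨u, w, hu, hw, huw, rfl⟩ : ∃ u w : ℕ, u < 4 ∧ w < 4 ∧ u ≠ w ∧ u + w = x := by
    by_cases h : x ≤ 3
    · exact ⟨0, x, by omega, by omega, by omega, by omega⟩
    · exact ⟨x - 3, 3, by omega, by omega, by omega, by omega⟩
  exact hmem u w hu hw huw

end LabelSums

/-! ### Prime modulus -/

section PrimeModulus

variable {ι : Type*} [DecidableEq ι] {p : ℕ}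

theorem card_sdiff_triple {Q : Finset ι} {i j k : ι} (hi : i ∈ Q) (hj : j ∈ Q) (hk : k ∈ Q)
    (ij : i ≠ j) (ik : i ≠ k) (jk : j ≠ k) :
    ({i, j, k} : Finset ι) ⊆ Q ∧ (Q \ {i, j, k}).card + 3 = Q.card := by
  have hsub : ({i, j, k} : Finset ι) ⊆ Q := by
    intro t ht
    simp only [Finset.mem_insert, Finset.mem_singleton] at ht
    rcases ht with rfl | rfl | rfl <;> assumption
  refine ⟨hsub, ?_⟩
  rw [← Finset.card_sdiff_add_card_eq_card hsub,
    Finset.card_eq_three.2 ⟨i, j, k, ij, ik, jk, rfl⟩]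

/-- A nonconstant sequence of `m ≤ p` residues has at least `m` weighted sums with weights
`0, …, m - 1`, except possibly when `m = p` and all but two of its terms agree. -/
theorem card_le_card_labelSums [NeZero p] {a : ι → ZMod p} (hp : p.Prime) (hp5 : 5 ≤ p) (m : ℕ) :
    ∀ Q : Finset ι, Q.card = m → m ≤ p → (∃ i ∈ Q, ∃ j ∈ Q, a i ≠ a j) →
      (m < p ∨ ¬ ∃ j ∈ Q, ∃ k ∈ Q, j ≠ k ∧ ∃ c, ∀ i ∈ Q, i ≠ j → i ≠ k → a i = c) →
      m ≤ (labelSums p Q a).card := by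
  induction m using Nat.strong_induction_on with
  | _ m ih =>
  intro Q hQ hmp hne hor
  obtain ⟨i₀, hi₀, j₀, hj₀, hij₀⟩ := hne
  have hm2 : 2 ≤ m := by
    rw [← hQ]
    exact Finset.one_lt_card.2 ⟨i₀, hi₀, j₀, hj₀, fun h => hij₀ (h ▸ rfl)⟩
  by_cases hpair : ∃ j ∈ Q, ∃ k ∈ Q, j ≠ k ∧ ∃ c, ∀ i ∈ Q, i ≠ j → i ≠ k → a i = c
  · have hlt : m < p := hor.resolve_right (not_not.2 hpair)
    obtain ⟨j, hj, k, hk, hjk, c, hc⟩ := hpair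
    have single : ∀ t ∈ Q, ∀ c, a t ≠ c → (∀ i ∈ Q, i ≠ t → a i = c) →
        m ≤ (labelSums p Q a).card := by
      intro t ht c h1 h2
      rw [← hQ]
      exact card_labelSums_of_single hp ht (by omega) (by omega) h2 h1
    by_cases h1 : a j = c
    · refine single k hk c ?_ ?_
      · intro h2
        have : ∀ i ∈ Q, a i = c := by
          intro i hi
          by_cases h3 : i = j
          · rw [h3, h1]
          by_cases h4 : i = k
          · rw [h4, h2]
          exact hc i hi h3 h4
        exact hij₀ ((this _ hi₀).trans (this _ hj₀).symm)
      · intro i hi h4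
        by_cases h3 : i = j
        · rw [h3, h1]
        exact hc i hi h3 h4
    by_cases h2 : a k = c
    · refine single j hj c h1 fun i hi h3 => ?_
      by_cases h4 : i = k
      · rw [h4, h2]
      exact hc i hi h3 h4
    by_cases hm3 : 3 ≤ m
    · rw [← hQ]
      exact card_labelSums_of_pair hp hj hk hjk (by omega) (by omega) hc h1 h2
    · have hQ' : Q = {j, k} := by
        symm
        apply Finset.eq_of_subset_of_card_le
        · intro t ht
          simp only [Finset.mem_insert, Finset.mem_singleton] at ht
          rcases ht with rfl | rfl <;> assumption
        · rw [Finset.card_pair hjk]; omega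
      have hmem : ∀ i ∈ Q, i = j ∨ i = k := by
        intro i hi; rw [hQ'] at hi; simpa using hi
      refine single j hj (a k) ?_ ?_
      · intro h
        apply hij₀
        rcases hmem _ hi₀ with rfl | rfl <;> rcases hmem _ hj₀ with rfl | rfl <;> simp [h]
      · intro i hi h
        rw [(hmem i hi).resolve_left h]
  · by_cases h3 : ∃ i ∈ Q, ∃ j ∈ Q, ∃ k ∈ Q, a i ≠ a j ∧ a i ≠ a k ∧ a j ≠ a k
    -- A triple of distinct values contributes 4 sums, and 4 + (m - 3) - 1 = m, so the remainder
    -- need only contribute m - 3.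
    · have triple : ∀ i ∈ Q, ∀ j ∈ Q, ∀ k ∈ Q, a i ≠ a j → a i ≠ a k → a j ≠ a k →
          m - 3 ≤ (labelSums p (Q \ {i, j, k}) a).card → m ≤ (labelSums p Q a).card := by
        intro i hi j hj k hk hij hik hjk h
        obtain ⟨hsub, -⟩ := card_sdiff_triple hi hj hk (fun h => hij (h ▸ rfl))
          (fun h => hik (h ▸ rfl)) (fun h => hjk (h ▸ rfl))
        have h1 := min_le_card_labelSums (a := a) hp hsub
        have h2 := four_le_card_labelSums hp hp5 hij hik hjk
        omega
      obtain ⟨i, hi, j, hj, k, hk, hij, hik, hjk⟩ := h3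
      have ij : i ≠ j := fun h => hij (h ▸ rfl)
      have ik : i ≠ k := fun h => hik (h ▸ rfl)
      have jk : j ≠ k := fun h => hjk (h ▸ rfl)
      obtain ⟨-, hcard⟩ := card_sdiff_triple hi hj hk ij ik jk
      by_cases hrest : ∃ s ∈ Q \ {i, j, k}, ∃ t ∈ Q \ {i, j, k}, a s ≠ a t
      · exact triple i hi j hj k hk hij hik hjk
          (ih (m - 3) (by omega) _ (by omega) (by omega) hrest (Or.inl (by omega)))
      push Not at hrest
      by_cases hsmall : m ≤ 4
      · refine triple i hi j hj k hk hij hik hjk ?_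
        have := Finset.card_pos.2 (labelSums_nonempty (p := p) (Q := Q \ {i, j, k}) (a := a))
        omega
      -- The remainder is constant with at least two members, and its value differs from those of i,
      -- j, k, since otherwise all but two coefficients would agree. The triple i, j, r then leaves
      -- the unequal pair k, s behind.
      obtain ⟨r, hr, s, hs, hrs⟩ :=
        Finset.one_lt_card.1 (by omega : 1 < (Q \ {i, j, k}).card)
      simp only [Finset.mem_sdiff, Finset.mem_insert, Finset.mem_singleton, not_or] at hr hs
      have hall : ∀ t ∈ Q, t ≠ i → t ≠ j → t ≠ k → a t = a r := by
        intro t ht h1 h2 h3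
        exact hrest t (by simp [ht, h1, h2, h3]) r (by simp [hr])
      have hri : a r ≠ a i := by
        intro h
        refine hpair ⟨j, hj, k, hk, jk, a i, fun t ht h1 h2 => ?_⟩
        by_cases h3 : t = i
        · rw [h3]
        · rw [hall t ht h3 h1 h2, h]
      have hrj : a r ≠ a j := by
        intro h
        refine hpair ⟨i, hi, k, hk, ik, a j, fun t ht h1 h2 => ?_⟩
        by_cases h3 : t = j
        · rw [h3]
        · rw [hall t ht h1 h3 h2, h]
      have hrk : a r ≠ a k := by
        intro h
        refine hpair ⟨i, hi, j, hj, ij, a k, fun t ht h1 h2 => ?_⟩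
        by_cases h3 : t = k
        · rw [h3]
        · rw [hall t ht h1 h2 h3, h]
      obtain ⟨-, hcard'⟩ := card_sdiff_triple hi hj hr.1 ij (Ne.symm hr.2.1) (Ne.symm hr.2.2.1)
      refine triple i hi j hj r hr.1 hij hri.symm hrj.symm
        (ih (m - 3) (by omega) _ (by omega) (by omega) ?_ (Or.inl (by omega)))
      refine ⟨k, ?_, s, ?_, ?_⟩
      · simp [hk, ik.symm, jk.symm, Ne.symm hr.2.2.2]
      · simp [hs, hrs.symm]
      · rw [hall s hs.1 hs.2.1 hs.2.2.1 hs.2.2.2]; exact hrk.symm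
    · push Not at h3
      have hval : ∀ t ∈ Q, a t = a i₀ ∨ a t = a j₀ := by
        intro t ht
        by_contra! h
        exact h.2.symm (h3 i₀ hi₀ j₀ hj₀ t ht hij₀ h.1.symm)
      -- each of the two values occurs at least three times
      have three : ∀ v w : ZMod p, v ≠ w → (∀ t ∈ Q, a t = v ∨ a t = w) →
          3 ≤ (Q.filter fun t => a t = v).card := by
        intro v w hvw hvals
        by_contra! hlt
        have hother : ∀ s ∈ Q, s ∉ Q.filter (fun t => a t = v) → a s = w := by
          intro s hs h
          exact (hvals s hs).resolve_left fun h' => h (Finset.mem_filter.2 ⟨hs, h'⟩)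
        obtain ⟨F, hF1, hF2, hF3⟩ := Finset.exists_subsuperset_card_eq
          (Finset.filter_subset (fun t => a t = v) Q) (by omega : _ ≤ 2) (by omega)
        obtain ⟨s, t, hst, rfl⟩ := Finset.card_eq_two.1 hF3
        refine hpair ⟨s, hF2 (by simp), t, hF2 (by simp), hst, w, fun u hu h1 h2 => ?_⟩
        exact hother u hu fun h => by simpa [h1, h2] using hF1 h
      obtain ⟨i₁, i₂, i₃, hi₁, hi₂, hi₃, d12, d13, d23⟩ :=
        Finset.two_lt_card_iff.1 (three _ _ hij₀ hval)
      obtain ⟨j₁, j₂, j₃, hj₁, hj₂, hj₃, e12, e13, e23⟩ :=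
        Finset.two_lt_card_iff.1 (three _ _ hij₀.symm fun t ht => (hval t ht).symm)
      simp only [Finset.mem_filter] at hi₁ hi₂ hi₃ hj₁ hj₂ hj₃
      have hne : ∀ s t, a s = a i₀ → a t = a j₀ → s ≠ t := by
        rintro s t h1 h2 rfl
        exact hij₀ (h1.symm.trans h2)
      have hsub : ({i₁, i₂, j₁, j₂} : Finset ι) ⊆ Q := by
        intro t ht
        simp only [Finset.mem_insert, Finset.mem_singleton] at ht
        rcases ht with rfl | rfl | rfl | rfl <;> tauto
      have hfour : ({i₁, i₂, j₁, j₂} : Finset ι).card = 4 := by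
        rw [Finset.card_insert_of_notMem, Finset.card_insert_of_notMem, Finset.card_pair e12]
        · simp [hne i₂ j₁ hi₂.2 hj₁.2, hne i₂ j₂ hi₂.2 hj₂.2]
        · simp [d12, hne i₁ j₁ hi₁.2 hj₁.2, hne i₁ j₂ hi₁.2 hj₂.2]
      have hcard := Finset.card_sdiff_add_card_eq_card hsub
      -- Two indices of each value contribute 5 sums, and 5 + (m - 4) - 1 = m; the third of each
      -- kind keeps the remainder nonconstant.
      have h5 := five_le_card_labelSums (a := a) hp hp5 d12 e12 (hi₁.2.trans hi₂.2.symm)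
        (hj₁.2.trans hj₂.2.symm) (by rw [hi₁.2, hj₁.2]; exact hij₀)
      have h6 := min_le_card_labelSums (a := a) hp hsub
      have h7 := ih (m - 4) (by omega) (Q \ {i₁, i₂, j₁, j₂}) (by omega) (by omega)
        ⟨i₃, by simp [hi₃.1, d13.symm, d23.symm, hne i₃ j₁ hi₃.2 hj₁.2, hne i₃ j₂ hi₃.2 hj₂.2],
          j₃, by simp [hj₃.1, e13.symm, e23.symm, (hne i₁ j₃ hi₁.2 hj₃.2).symm,
            (hne i₂ j₃ hi₂.2 hj₃.2).symm], by rw [hi₃.2, hj₃.2]; exact hij₀⟩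
        (Or.inl (by omega))
      omega

/-- The main theorem for a prime modulus. -/
theorem solvableOn_of_prime {P : Finset ι} {a : ι → ℤ} (hp : p.Prime) (hP : P.card = p)
    (hne : ¬ ConstModOn p P a) (hex : ¬ ExceptionalOn p P a) (α : ℤ) : SolvableOn p P a α := by
  have hs : SpreadOn p P a := by
    intro q hq hqp
    rwa [(Nat.prime_dvd_prime_iff_eq hq hp).1 hqp]
  by_cases hpair : ∃ j ∈ P, ∃ k ∈ P, j ≠ k ∧ ∃ c : ℤ, ∀ i ∈ P, i ≠ j → i ≠ k → a i ≡ c [ZMOD p]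
  · obtain ⟨j, hj, k, hk, hjk, c, hc⟩ := hpair
    exact solvableOn_of_pair hP hj hk hjk hc hs hex α
  have : NeZero p := ⟨hp.ne_zero⟩
  -- For p ≤ 3 at most one index lies outside a suitable pair, contradicting `hpair`.
  have hp5 : 5 ≤ p := by
    by_contra! hlt
    have hp3 : p ≤ 3 := by
      by_contra! h
      have : p = 4 := by omega
      subst this; revert hp; decide
    obtain ⟨i, j, hij, hPij⟩ : ∃ j k, j ≠ k ∧ ∃ l, P ⊆ {j, k, l} ∧ j ∈ P ∧ k ∈ P := by
      obtain h2 | h3 : p = 2 ∨ p = 3 := by have := hp.two_le; omega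
      · obtain ⟨j, k, hjk, rfl⟩ := Finset.card_eq_two.1 (hP.trans h2)
        exact ⟨j, k, hjk, j, by intro; simp; tauto, by simp, by simp⟩
      · obtain ⟨j, k, l, hjk, -, -, rfl⟩ := Finset.card_eq_three.1 (hP.trans h3)
        exact ⟨j, k, hjk, l, subset_rfl, by simp, by simp⟩
    obtain ⟨l, hsub, hi, hj⟩ := hPij
    refine hpair ⟨i, hi, j, hj, hij, a l, fun t ht h1 h2 => ?_⟩
    have := hsub ht
    simp only [Finset.mem_insert, Finset.mem_singleton] at this
    rw [(this.resolve_left h1).resolve_left h2]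
  have hcard := card_le_card_labelSums (a := fun i => (a i : ZMod p)) hp hp5 p P hP le_rfl
    (by
      unfold ConstModOn at hne
      push Not at hne
      obtain ⟨i, hi, j, hj, h⟩ := hne
      exact ⟨i, hi, j, hj, fun h' => h ((ZMod.intCast_eq_intCast_iff _ _ _).1 h')⟩)
    (Or.inr (by
      rintro ⟨j, hj, k, hk, hjk, c, hc⟩
      refine hpair ⟨j, hj, k, hk, hjk, c.val, fun i hi h1 h2 => ?_⟩
      rw [← ZMod.intCast_eq_intCast_iff, hc i hi h1 h2]
      simp))
  have huniv : labelSums p P (fun i => (a i : ZMod p)) = Finset.univ := by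
    apply Finset.eq_univ_of_card
    rw [ZMod.card]
    refine le_antisymm ?_ hcard
    calc _ ≤ (Finset.univ : Finset (ZMod p)).card := Finset.card_le_univ _
      _ = p := by simp [ZMod.card]
  have hmem : (α : ZMod p) ∈ labelSums p P (fun i => (a i : ZMod p)) := by
    rw [huniv]; exact Finset.mem_univ _
  obtain ⟨z, hz, hlt, hsum⟩ := mem_labelSums.1 hmem
  refine ⟨fun i => z i, ?_, ?_⟩
  · intro i hi j hj hij
    have h1 := hlt i hi
    have h2 := hlt j hj
    exact hz hi hj (Nat.ModEq.eq_of_lt_of_lt (Int.natCast_modEq_iff.1 hij) (by omega) (by omega))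
  · rw [← ZMod.intCast_eq_intCast_iff, ← hsum]
    push_cast
    rfl

/-- Among at least `p + 1` residues modulo `p`, not all equal, one can choose `p` that are neither
all equal nor exceptional. -/
theorem exists_subset_not_exceptionalOn {J : Finset ι} {a : ι → ℤ} (hp : p.Prime)
    (hJ : p + 1 ≤ J.card ∨ p = 2) (hne : ¬ ConstModOn p J a) :
    ∃ Q ⊆ J, Q.card = p ∧ ¬ ConstModOn p Q a ∧ ¬ ExceptionalOn p Q a := by
  unfold ConstModOn at hne
  push Not at hne
  obtain ⟨i, hi, j, hj, hij⟩ := hne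
  have ij : i ≠ j := fun h => hij (h ▸ rfl)
  have hsub : ({i, j} : Finset ι) ⊆ J := by
    intro t ht
    simp only [Finset.mem_insert, Finset.mem_singleton] at ht
    rcases ht with rfl | rfl <;> assumption
  have hJ' : p ≤ J.card := by
    rcases hJ with h | rfl
    · omega
    · rw [← Finset.card_pair ij]; exact Finset.card_le_card hsub
  obtain ⟨Q, hQ1, hQ2, hQ3⟩ := Finset.exists_subsuperset_card_eq hsub
    (by rw [Finset.card_pair ij]; exact hp.two_le) hJ'
  by_cases hex : ExceptionalOn p Q a
  swap
  · exact ⟨Q, hQ2, hQ3, fun h => hij (h i (hQ1 (by simp)) j (hQ1 (by simp))), hex⟩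
  have hp3 := hex.three_le hQ3
  obtain ⟨e, heJ, heQ⟩ := Finset.exists_mem_notMem_of_card_lt_card
    (by rcases hJ with h | h <;> omega : Q.card < J.card)
  have hsum := hex.sum_modEq_zero hQ3
  obtain ⟨j, hj, k, hk, l, hl, hjk, hjl, hkl, he, hco, hc⟩ := hex
  rw [isCoprime_natPrime_iff hp] at hco
  have hjl' : ¬ a j ≡ a l [ZMOD p] := fun h => hco (by simpa using h.sub_right (a l))
  have hkl' : ¬ a k ≡ a l [ZMOD p] := by
    intro h
    apply hjl'
    have := he.sub h
    convert this using 1 <;> ring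
  -- Replace s by e. The set stays nonconstant because t and l remain, and its coefficient sum is no
  -- longer 0 modulo p, so it is not exceptional.
  have key : ∀ s ∈ Q, ∀ t ∈ Q, s ≠ t → s ≠ l → ¬ a t ≡ a l [ZMOD p] → ¬ a e ≡ a s [ZMOD p] →
      ∃ Q ⊆ J, Q.card = p ∧ ¬ ConstModOn p Q a ∧ ¬ ExceptionalOn p Q a := by
    intro s hs t ht hst hsl htl hes
    have heQ' : e ∉ Q.erase s := fun h => heQ (Finset.mem_of_mem_erase h)
    have hcard : (insert e (Q.erase s)).card = p := by
      rw [Finset.card_insert_of_notMem heQ', Finset.card_erase_of_mem hs, hQ3]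
      have := hp.pos; omega
    refine ⟨insert e (Q.erase s), ?_, hcard, ?_, ?_⟩
    · intro x hx
      rcases Finset.mem_insert.1 hx with rfl | hx
      · exact heJ
      · exact hQ2 (Finset.mem_of_mem_erase hx)
    · intro h
      exact htl (h t (by simp [hst.symm, ht]) l (by simp [hsl.symm, hl]))
    · intro h
      have h1 := h.sum_modEq_zero hcard
      rw [Finset.sum_insert heQ'] at h1
      rw [← Finset.add_sum_erase _ _ hs] at hsum
      exact hes ((h1.trans hsum.symm).add_right_cancel' _)
  by_cases hej : a e ≡ a j [ZMOD p]
  · refine key k hk j hj hjk.symm hkl hjl' fun h => ?_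
    have h1 := hej.symm.trans h
    -- then `2 * a j ≡ 2 * a l` with `p` odd
    have h2 : (p : ℤ) ∣ 2 * (a j - a l) := by
      have := (h1.add_left (a j)).trans he
      obtain ⟨t, ht⟩ := this.dvd
      exact ⟨-t, by linear_combination -ht⟩
    rcases (Nat.prime_iff_prime_int.1 hp).dvd_or_dvd h2 with h3 | h3
    · have := Int.le_of_dvd (by norm_num) h3
      omega
    · exact hjl' (Int.modEq_iff_dvd.2 h3).symm
  · exact key j hj k hk hjk hjl hkl' hej

end PrimeModulus

/-! ### Relabelling residue classes of labels -/

section Classes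

variable {ι : Type*} {q N : ℕ} {P : Finset ι} {a y z : ι → ℤ} {r α : ℤ}

/-- The indices in `P` whose label is congruent to `r` modulo `q`. -/
def residueClass (q : ℕ) (P : Finset ι) (y : ι → ℤ) (r : ℤ) : Finset ι :=
  P.filter fun i => y i ≡ r [ZMOD q]

theorem mem_residueClass {i : ι} : i ∈ residueClass q P y r ↔ i ∈ P ∧ y i ≡ r [ZMOD q] := by
  simp [residueClass]

theorem residueClass_subset : residueClass q P y r ⊆ P := Finset.filter_subset _ _

theorem Int.ModEq.exists_eq_add_mul {x r q : ℤ} (h : x ≡ r [ZMOD q]) : ∃ w, x = r + q * w := by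
  obtain ⟨w, hw⟩ := h.symm.dvd
  exact ⟨w, by linear_combination hw⟩

theorem add_mul_modEq_iff (hq : 0 < q) {u v : ℤ} :
    r + q * u ≡ r + q * v [ZMOD (q * N : ℕ)] ↔ u ≡ v [ZMOD N] := by
  push_cast
  constructor
  · intro h
    exact Int.ModEq.mul_left_cancel' (by positivity) (Int.ModEq.add_left_cancel' _ h)
  · intro h
    exact (Int.ModEq.mul_left' h).add_left r

variable [DecidableEq ι]

theorem DistinctModOn.card_residueClass (hy : DistinctModOn (q * N) P y) (hP : P.card = q * N)
    (hq : 0 < q) (hN : 0 < N) (r : ℤ) : (residueClass q P y r).card = N := by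
  have hex : ∀ z : ℕ, ∃ i ∈ P, y i ≡ r + q * z [ZMOD (q * N : ℕ)] := fun z =>
    hy.exists_modEq hP (Nat.mul_pos hq hN) _
  choose g hgP hg using hex
  have himg : residueClass q P y r = (Finset.range N).image g := by
    ext i
    rw [mem_residueClass, Finset.mem_image]
    constructor
    · rintro ⟨hi, hr⟩
      obtain ⟨w, hw⟩ := hr.exists_eq_add_mul
      have hN' : (0 : ℤ) < N := by exact_mod_cast hN
      obtain ⟨v, hv⟩ := Int.eq_ofNat_of_zero_le (Int.emod_nonneg w hN'.ne')
      refine ⟨v, ?_, ?_⟩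
      · rw [Finset.mem_range]
        have := Int.emod_lt_of_pos w hN'
        omega
      · refine hy _ (hgP v) _ hi ((hg v).trans ?_)
        rw [hw, add_mul_modEq_iff hq]
        rw [← hv]
        exact Int.mod_modEq w N
    · rintro ⟨v, -, rfl⟩
      refine ⟨hgP v, ((hg v).of_dvd_nat (dvd_mul_right q N)).trans ?_⟩
      exact Int.modEq_iff_dvd.2 ⟨-v, by ring⟩
  rw [himg, Finset.card_image_of_injOn, Finset.card_range]
  intro u hu v hv huv
  have h1 : r + q * (u : ℤ) ≡ r + q * (v : ℤ) [ZMOD (q * N : ℕ)] :=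
    (hg u).symm.trans (by rw [huv]; exact hg v)
  rw [add_mul_modEq_iff hq, Int.natCast_modEq_iff] at h1
  exact h1.eq_of_lt_of_lt (by simpa using hu) (by simpa using hv)

/-- Relabelling one residue class modulo `q`. -/
theorem DistinctModOn.replace_class (hy : DistinctModOn (q * N) P y) (hq : 0 < q)
    (hz : DistinctModOn N (residueClass q P y r) z) :
    DistinctModOn (q * N) P
      (fun i => if i ∈ residueClass q P y r then r + q * z i else y i) := by
  have hr : ∀ w : ℤ, r + q * w ≡ r [ZMOD q] := fun w =>
    Int.modEq_iff_dvd.2 ⟨-w, by ring⟩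
  intro i hi j hj hij
  by_cases h1 : i ∈ residueClass q P y r <;> by_cases h2 : j ∈ residueClass q P y r
  · simp only [if_pos h1, if_pos h2] at hij
    rw [add_mul_modEq_iff hq] at hij
    exact hz i h1 j h2 hij
  · simp only [if_pos h1, if_neg h2] at hij
    exact absurd (mem_residueClass.2 ⟨hj,
      (hij.symm.of_dvd_nat (dvd_mul_right q N)).trans (hr _)⟩) h2
  · simp only [if_neg h1, if_pos h2] at hij
    exact absurd (mem_residueClass.2 ⟨hi,
      (hij.of_dvd_nat (dvd_mul_right q N)).trans (hr _)⟩) h1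
  · simp only [if_neg h1, if_neg h2] at hij
    exact hy i hi j hj hij

theorem sum_replace_class (q : ℕ) (P : Finset ι) (a y z : ι → ℤ) (r : ℤ) :
    ∑ i ∈ P, a i * (if i ∈ residueClass q P y r then r + q * z i else y i) =
      ∑ i ∈ P, a i * y i + ∑ i ∈ residueClass q P y r, a i * (r + q * z i - y i) := by
  rw [← Finset.sum_sdiff (residueClass_subset (q := q) (P := P) (y := y) (r := r)),
    ← Finset.sum_sdiff (s₂ := P) (f := fun i => a i * y i)
      (residueClass_subset (q := q) (P := P) (y := y) (r := r)), add_assoc]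
  congr 1
  · exact Finset.sum_congr rfl fun i hi => by rw [if_neg (Finset.mem_sdiff.1 hi).2]
  · rw [← Finset.sum_add_distrib]
    exact Finset.sum_congr rfl fun i hi => by rw [if_pos hi]; ring

/-- Replacing the labels r + q w by r + q z changes the total by q(Σ a z - Σ a w). A defect of q t
is thus repaired by moving Σ a w to Σ a w + t modulo `N`. -/
theorem solvableOn_of_class {w : ι → ℤ} {t : ℤ} (hy : DistinctModOn (q * N) P y) (hq : 0 < q)
    (hw : ∀ i ∈ residueClass q P y r, y i = r + q * w i)
    (ht : ∑ i ∈ P, a i * y i + q * t = α)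
    (hs : SolvableOn N (residueClass q P y r) a
      (∑ i ∈ residueClass q P y r, a i * w i + t)) : SolvableOn (q * N) P a α := by
  obtain ⟨z, hz, hza⟩ := hs
  refine ⟨_, hy.replace_class hq hz, ?_⟩
  rw [sum_replace_class]
  have h1 : ∑ i ∈ residueClass q P y r, a i * (r + q * z i - y i) =
      q * (∑ i ∈ residueClass q P y r, a i * z i - ∑ i ∈ residueClass q P y r, a i * w i) := by
    rw [← Finset.sum_sub_distrib, Finset.mul_sum]
    exact Finset.sum_congr rfl fun i hi => by rw [hw i hi]; ring
  rw [h1, ← ht]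
  apply Int.ModEq.add_left
  push_cast
  apply Int.ModEq.mul_left'
  have := hza.sub_right (∑ i ∈ residueClass q P y r, a i * w i)
  rwa [add_sub_cancel_left] at this

theorem DistinctModOn.comp_swap {n : ℕ} (hy : DistinctModOn n P y) {g h : ι} (hg : g ∈ P)
    (hh : h ∈ P) : DistinctModOn n P (fun i => y (Equiv.swap g h i)) := by
  have hmem : ∀ i ∈ P, Equiv.swap g h i ∈ P := by
    intro i hi
    rw [Equiv.swap_apply_def]
    split_ifs <;> assumption
  intro i hi j hj hij
  exact (Equiv.swap g h).injective (hy _ (hmem i hi) _ (hmem j hj) hij)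

theorem sum_comp_swap {g h : ι} (hg : g ∈ P) (hh : h ∈ P) (hgh : g ≠ h) (a y : ι → ℤ) :
    ∑ i ∈ P, a i * y (Equiv.swap g h i) = ∑ i ∈ P, a i * y i + (a g - a h) * (y h - y g) := by
  have hh' : h ∈ P.erase g := Finset.mem_erase.2 ⟨hgh.symm, hh⟩
  rw [← Finset.add_sum_erase P _ hg, ← Finset.add_sum_erase _ _ hh',
    ← Finset.add_sum_erase P (fun i => a i * y i) hg,
    ← Finset.add_sum_erase _ (fun i => a i * y i) hh',
    Finset.sum_congr (s₁ := (P.erase g).erase h) (g := fun i => a i * y i) rfl (fun i hi => by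
      simp only [Finset.mem_erase] at hi
      rw [Equiv.swap_apply_of_ne_of_ne hi.2.1 hi.1])]
  simp only [Equiv.swap_apply_left, Equiv.swap_apply_right]
  ring

/-- Lifting a solution modulo `q` to one modulo `q * N` by relabelling a residue class `C` modulo
`q`: this fails only if `C` is exceptional and `a` is constant on all the other classes. -/
theorem solvableOn_or_of_class
    (hT : ∀ C : Finset ι, C.card = N → SpreadOn N C a → ¬ ExceptionalOn N C a →
      ∀ β, SolvableOn N C a β)
    (hP : P.card = q * N) (hq : 0 < q) (hN : 0 < N) (hy : DistinctModOn (q * N) P y)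
    (hα : ∑ i ∈ P, a i * y i ≡ α [ZMOD q]) (hs : SpreadOn N (residueClass q P y r) a) :
    SolvableOn (q * N) P a α ∨ (ExceptionalOn N (residueClass q P y r) a ∧
      ∀ g ∈ P, ∀ h ∈ P, ¬ y g ≡ r [ZMOD q] → y g ≡ y h [ZMOD q] → a g ≡ a h [ZMOD N]) := by
  have hcard := hy.card_residueClass hP hq hN r
  have hwex : ∀ i, ∃ w, i ∈ residueClass q P y r → y i = r + q * w := by
    intro i
    by_cases hi : i ∈ residueClass q P y r
    · obtain ⟨w, hw⟩ := (mem_residueClass.1 hi).2.exists_eq_add_mul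
      exact ⟨w, fun _ => hw⟩
    · exact ⟨0, fun h => absurd h hi⟩
  choose w hw using hwex
  by_cases hex : ExceptionalOn N (residueClass q P y r) a
  swap
  · left
    obtain ⟨t, ht⟩ := hα.symm.exists_eq_add_mul
    exact solvableOn_of_class hy hq hw ht.symm (hT _ hcard hs hex _)
  by_contra! hcon
  obtain ⟨hns, hcon⟩ := hcon
  obtain ⟨g, hgP, h, hhP, hgr, hgh, hagh⟩ := hcon hex
  have hne : g ≠ h := fun e => hagh (e ▸ rfl)
  set C₁ := residueClass q P y (y g) with hC₁
  have hg₁ : g ∈ C₁ := mem_residueClass.2 ⟨hgP, rfl⟩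
  have hh₁ : h ∈ C₁ := mem_residueClass.2 ⟨hhP, hgh.symm⟩
  have hcard₁ : C₁.card = N := hy.card_residueClass hP hq hN (y g)
  have hN3 := hex.three_le hcard
  obtain ⟨z, hz, hzf⟩ := DistinctModOn.exists_extend (W := {g, h})
    (f := fun i => if i = g then 0 else 1) hcard₁ hN
    (by
      have h01 : ¬ (0 : ℤ) ≡ 1 [ZMOD N] := by
        intro h
        have := Int.le_of_dvd (by norm_num) h.dvd
        omega
      intro i hi i' hi' h
      simp only [Finset.mem_insert, Finset.mem_singleton] at hi hi'
      rcases hi with rfl | rfl <;> rcases hi' with rfl | rfl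
      · rfl
      · simp [hne.symm] at h; exact absurd h h01
      · simp [hne.symm] at h; exact absurd h.symm h01
      · rfl)
  have hzg : z g = 0 := by simpa using hzf g (by simp)
  have hzh : z h = 1 := by simpa [hne.symm] using hzf h (by simp)
  -- relabel the class of `g` and `h` so that their labels differ by `q`, in both orders
  have main : ∀ z : ι → ℤ, DistinctModOn N C₁ z → ∀ t : ℤ,
      ∑ i ∈ P, a i * (if i ∈ C₁ then y g + q * z i else y i) + q * t = α →
      ¬ SolvableOn N (residueClass q P y r) a (∑ i ∈ residueClass q P y r, a i * w i + t) := by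
    intro z hz t ht hsol
    have hcls : residueClass q P (fun i => if i ∈ C₁ then y g + q * z i else y i) r =
        residueClass q P y r := by
      ext i
      rw [mem_residueClass, mem_residueClass (y := y) (r := r)]
      by_cases hi : i ∈ C₁
      · simp only [if_pos hi]
        have h1 : y i ≡ y g [ZMOD q] := (mem_residueClass.1 hi).2
        have h2 : y g + q * z i ≡ y g [ZMOD q] := Int.modEq_iff_dvd.2 ⟨-z i, by ring⟩
        constructor
        · rintro ⟨-, h3⟩; exact absurd (h2.symm.trans h3) hgr
        · rintro ⟨-, h3⟩; exact absurd (h1.symm.trans h3) hgr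
      · simp only [if_neg hi]
    refine hns (solvableOn_of_class (w := w) (t := t) (r := r) (hy.replace_class hq hz) hq ?_ ht ?_)
    · intro i hi
      rw [hcls] at hi
      have hi' : i ∉ C₁ := by
        intro h1
        exact hgr ((mem_residueClass.1 h1).2.symm.trans (mem_residueClass.1 hi).2)
      exact (if_neg hi').trans (hw i hi)
    · rw [hcls]; exact hsol
  have hsumq : ∀ z : ι → ℤ,
      ∑ i ∈ P, a i * (if i ∈ C₁ then y g + q * z i else y i) ≡ α [ZMOD q] := by
    intro z
    refine Int.ModEq.trans (Int.ModEq.sum fun i hi => Int.ModEq.mul_left _ ?_) hα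
    by_cases h1 : i ∈ C₁
    · rw [if_pos h1]
      refine Int.ModEq.trans ?_ (mem_residueClass.1 h1).2.symm
      exact Int.modEq_iff_dvd.2 ⟨-z i, by ring⟩
    · rw [if_neg h1]
  obtain ⟨t₁, ht₁⟩ := (hsumq z).symm.exists_eq_add_mul
  have hz₂ := hz.comp_swap hg₁ hh₁
  obtain ⟨t₂, ht₂⟩ := (hsumq (fun i => z (Equiv.swap g h i))).symm.exists_eq_add_mul
  -- The exchange changes the sum by q(a_g - a_h), so the two targets for the exceptional class are
  -- incongruent modulo `N`, and at most one of them is missed.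
  have hdiff : t₁ = t₂ + (a g - a h) := by
    have e1 := sum_replace_class q P a y z (y g)
    have e2 := sum_replace_class q P a y (fun i => z (Equiv.swap g h i)) (y g)
    have e3 : ∑ i ∈ C₁, a i * (y g + q * z (Equiv.swap g h i) - y i) =
        ∑ i ∈ C₁, a i * (y g + q * z i - y i) + q * (a g - a h) := by
      have h1 : ∀ v : ι → ℤ, ∑ i ∈ C₁, a i * (y g + q * v i - y i) =
          ∑ i ∈ C₁, a i * (y g - y i) + q * ∑ i ∈ C₁, a i * v i := by
        intro v
        rw [Finset.mul_sum, ← Finset.sum_add_distrib]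
        exact Finset.sum_congr rfl fun i _ => by ring
      rw [h1, h1 z, sum_comp_swap hg₁ hh₁ hne, hzg, hzh]
      ring
    rw [← hC₁] at e1 e2
    have hq0 : (q : ℤ) ≠ 0 := by positivity
    apply mul_left_cancel₀ hq0
    linear_combination ht₂ - ht₁ - e1 + e2 + e3
  rcases hex.solvableOn_or hcard (α := ∑ i ∈ residueClass q P y r, a i * w i + t₁)
    (β := ∑ i ∈ residueClass q P y r, a i * w i + t₂) (by
      intro h'
      have h1 := Int.ModEq.add_left_cancel' _ h'
      rw [hdiff] at h1
      apply hagh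
      have h2 := h1.sub_right t₂
      have h3 : a g - a h ≡ 0 [ZMOD N] := by convert h2 using 1 <;> ring
      simpa using h3.add_right (a h)) with h1 | h1
  · exact main z hz t₁ ht₁.symm h1
  · exact main _ hz₂ t₂ ht₂.symm h1

/-- Solving the congruence modulo a prime `q` with labels modulo `q * N`, when the labels on `W`
are prescribed and avoid `q * (N - 1), …, q * N - 1`. -/
theorem exists_solution_mod_prime {W : Finset ι} {f : ι → ℤ} (hq : q.Prime) (hN : 0 < N)
    (hP : P.card = q * N) (hf : DistinctModOn (q * N) W f)
    (hf0 : ∀ i ∈ W, 0 ≤ f i) (hflt : ∀ i ∈ W, f i < q * (N - 1))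
    (hcard : q + 1 ≤ (P \ W).card ∨ q = 2) (hne : ¬ ConstModOn q (P \ W) a) (α : ℤ) :
    ∃ y, DistinctModOn (q * N) P y ∧ (∀ i ∈ W, y i = f i) ∧
      ∑ i ∈ P, a i * y i ≡ α [ZMOD q] := by
  -- `Q` receives the top block of q consecutive labels, which represents every residue modulo q.
  -- The prime case permutes these labels among `Q` without disturbing any other label.
  obtain ⟨Q, hQ, hQcard, hQne, hQex⟩ := exists_subset_not_exceptionalOn hq hcard hne
  have hq0 : (0 : ℤ) < q := by exact_mod_cast hq.pos
  have hQP : Q ⊆ P := hQ.trans Finset.sdiff_subset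
  have hQW : ∀ i ∈ Q, i ∉ W := fun i hi => (Finset.mem_sdiff.1 (hQ hi)).2
  obtain ⟨e, he⟩ := exists_distinctModOn hQcard hq.pos
  -- labels in the top block are distinct modulo `q * N` when they are distinct modulo `q`
  have htop : ∀ u v : ℤ, q * ((N : ℤ) - 1) + u % q ≡ q * ((N : ℤ) - 1) + v % q [ZMOD (q * N : ℕ)] →
      u ≡ v [ZMOD q] := by
    intro u v h
    have h1 := (Int.ModEq.add_left_cancel' _ h).of_dvd_nat (dvd_mul_right q N)
    exact ((Int.mod_modEq u q).symm.trans h1).trans (Int.mod_modEq v q)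
  set F : ι → ℤ := fun i => if i ∈ W then f i else q * ((N : ℤ) - 1) + e i % q with hF
  have hN1 : (1 : ℤ) ≤ N := by exact_mod_cast hN
  have hlow : ∀ i ∈ W, ∀ u : ℤ, ¬ f i ≡ q * ((N : ℤ) - 1) + u % q [ZMOD (q * N : ℕ)] := by
    intro i hi u h
    have h1 := Int.emod_nonneg u hq0.ne'
    have h2 := Int.emod_lt_of_pos u hq0
    have h3 := hf0 i hi
    have h4 := hflt i hi
    have h5 : (q : ℤ) * N = q * ((N : ℤ) - 1) + q := by ring
    have h6 : f i = q * ((N : ℤ) - 1) + u % q := by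
      rw [Int.ModEq] at h
      push_cast at h
      rw [Int.emod_eq_of_lt h3 (by linarith), Int.emod_eq_of_lt (by linarith) (by linarith)] at h
      exact h
    linarith
  obtain ⟨y, hy, hyF⟩ := DistinctModOn.exists_extend (W := W ∪ Q) (f := F) hP
    (Nat.mul_pos hq.pos hN) (by
      intro i hi j hj hij
      simp only [Finset.mem_union] at hi hj
      by_cases h1 : i ∈ W <;> by_cases h2 : j ∈ W
      · simp only [hF, if_pos h1, if_pos h2] at hij
        exact hf i h1 j h2 hij
      · simp only [hF, if_pos h1, if_neg h2] at hij
        exact absurd hij (hlow i h1 _)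
      · simp only [hF, if_neg h1, if_pos h2] at hij
        exact absurd hij.symm (hlow j h2 _)
      · simp only [hF, if_neg h1, if_neg h2] at hij
        exact he i (hi.resolve_left h1) j (hj.resolve_left h2) (htop _ _ hij))
  have hyQ : ∀ i ∈ Q, y i = q * ((N : ℤ) - 1) + e i % q := by
    intro i hi
    rw [hyF i (Finset.mem_union_right _ hi)]
    simp only [hF, if_neg (hQW i hi)]
  obtain ⟨z, hz, hza⟩ := solvableOn_of_prime hq hQcard hQne hQex
    (α - ∑ i ∈ P \ Q, a i * y i)
  refine ⟨fun i => if i ∈ Q then q * ((N : ℤ) - 1) + z i % q else y i, ?_, ?_, ?_⟩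
  · have hout : ∀ i ∈ P, i ∉ Q → ∀ u : ℤ,
        ¬ y i ≡ q * ((N : ℤ) - 1) + u % q [ZMOD (q * N : ℕ)] := by
      intro i hi hiQ u h
      obtain ⟨k, hk, hku⟩ := he.exists_modEq hQcard hq.pos u
      have : y k = q * ((N : ℤ) - 1) + u % q := by rw [hyQ k hk, hku]
      exact hiQ (hy i hi k (hQP hk) (this ▸ h) ▸ hk)
    intro i hi j hj hij
    by_cases h1 : i ∈ Q <;> by_cases h2 : j ∈ Q
    · simp only [if_pos h1, if_pos h2] at hij
      exact hz i h1 j h2 (htop _ _ hij)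
    · simp only [if_pos h1, if_neg h2] at hij
      exact absurd hij.symm (hout j hj h2 _)
    · simp only [if_neg h1, if_pos h2] at hij
      exact absurd hij (hout i hi h1 _)
    · simp only [if_neg h1, if_neg h2] at hij
      exact hy i hi j hj hij
  · intro i hi
    have : i ∉ Q := fun h => hQW i h hi
    simp only [if_neg this]
    rw [hyF i (Finset.mem_union_left _ hi)]
    simp only [hF, if_pos hi]
  · rw [← Finset.sum_sdiff hQP]
    have h1 : ∑ i ∈ P \ Q, a i * (if i ∈ Q then q * ((N : ℤ) - 1) + z i % q else y i) =
        ∑ i ∈ P \ Q, a i * y i :=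
      Finset.sum_congr rfl fun i hi => by rw [if_neg (Finset.mem_sdiff.1 hi).2]
    have h2 : ∑ i ∈ Q, a i * (if i ∈ Q then q * ((N : ℤ) - 1) + z i % q else y i) ≡
        ∑ i ∈ Q, a i * z i [ZMOD q] := by
      refine Int.ModEq.sum fun i hi => Int.ModEq.mul_left _ ?_
      rw [if_pos hi]
      refine Int.ModEq.trans ?_ (Int.mod_modEq (z i) q)
      exact Int.modEq_iff_dvd.2 ⟨-((N : ℤ) - 1), by ring⟩
    rw [h1]
    have := (h2.trans hza).add_left (∑ i ∈ P \ Q, a i * y i)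
    rwa [add_sub_cancel] at this

end Classes

/-! ### Tools for the induction step -/

section Induction

variable {ι : Type*} [DecidableEq ι] {q N : ℕ} {P : Finset ι} {a : ι → ℤ}

theorem distinctModOn_of_lt {ι : Type*} {n : ℕ} {W : Finset ι} {f : ι → ℤ}
    (h0 : ∀ i ∈ W, 0 ≤ f i) (hlt : ∀ i ∈ W, f i < n)
    (hinj : ∀ i ∈ W, ∀ j ∈ W, f i = f j → i = j) : DistinctModOn n W f := by
  intro i hi j hj hij
  apply hinj i hi j hj
  rw [Int.ModEq, Int.emod_eq_of_lt (h0 i hi) (hlt i hi), Int.emod_eq_of_lt (h0 j hj) (hlt j hj)]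
    at hij
  exact hij

theorem Int.ModEq.isCoprime {d d' : ℤ} {n : ℕ} (h : d ≡ d' [ZMOD n]) (hd : IsCoprime d (n : ℤ)) :
    IsCoprime d' (n : ℤ) := by
  obtain ⟨t, rfl⟩ := h.symm.exists_eq_add_mul
  exact hd.add_mul_left_left t

theorem not_modEq_of_isCoprime_sub {ι : Type*} {a : ι → ℤ} {n : ℕ} (hn : 2 ≤ n) {j l : ι}
    (hco : IsCoprime (a j - a l) (n : ℤ)) : ¬ a j ≡ a l [ZMOD n] := by
  intro h
  have h0 : a j - a l ≡ 0 [ZMOD n] := by simpa using h.sub_right (a l)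
  have := (isCoprime_zero_left.1 (h0.isCoprime hco))
  rw [Int.isUnit_iff] at this
  omega

theorem isCoprime_sub_of_add_modEq {ι : Type*} {a : ι → ℤ} {n : ℕ} {j k l : ι}
    (he : a j + a k ≡ 2 * a l [ZMOD n])
    (hco : IsCoprime (a j - a l) (n : ℤ)) : IsCoprime (a k - a l) (n : ℤ) := by
  refine Int.ModEq.isCoprime ?_ hco.neg_left
  have := he.symm.sub_right (a l + a j)
  convert this using 1 <;> ring

/-- The main theorem modulo `q * N` when all but two coefficients agree modulo `N` and one of the
two deviations is invertible modulo `N`. -/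
theorem solvableOn_of_pair_mod {j k : ι} {c : ℤ} (hq : q.Prime) (hN : 3 ≤ N) (hP : P.card = q * N)
    (hj : j ∈ P) (hk : k ∈ P) (hjk : j ≠ k)
    (hc : ∀ i ∈ P, i ≠ j → i ≠ k → a i ≡ c [ZMOD N]) (hco : IsCoprime (a j - c) (N : ℤ))
    (hs : SpreadOn (q * N) P a) (hex : ¬ ExceptionalOn (q * N) P a) (α : ℤ) :
    SolvableOn (q * N) P a α := by
  have hq2 := hq.two_le
  have hqN : 2 * N ≤ q * N := Nat.mul_le_mul_right N hq2
  have hsub : ({j, k} : Finset ι) ⊆ P := by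
    intro t ht
    simp only [Finset.mem_insert, Finset.mem_singleton] at ht
    rcases ht with rfl | rfl <;> assumption
  have hcardW := Finset.card_sdiff_add_card_eq_card hsub
  rw [Finset.card_pair hjk] at hcardW
  have hmemW : ∀ {i}, i ∈ P \ {j, k} ↔ i ∈ P ∧ i ≠ j ∧ i ≠ k := by
    intro i; simp
  by_cases hconst : ConstModOn (q * N) (P \ {j, k}) a
  · obtain ⟨l, hl⟩ := Finset.card_pos.1 (by omega : 0 < (P \ {j, k}).card)
    exact solvableOn_of_pair hP hj hk hjk
      (fun i hi h1 h2 => hconst i (hmemW.2 ⟨hi, h1, h2⟩) l hl) hs hex α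
  set b : ι → ℤ := fun i => if i = j ∨ i = k then 0 else (a i - c) / N with hb
  have hbN : ∀ i ∈ P, i ≠ j → i ≠ k → a i = c + N * b i := by
    intro i hi h1 h2
    have : (N : ℤ) ∣ a i - c := (hc i hi h1 h2).symm.dvd
    simp only [hb, if_neg (not_or.2 ⟨h1, h2⟩)]
    rw [Int.mul_ediv_cancel' this]; ring
  have hbne : ¬ ConstModOn q (P \ {j, k}) b := by
    intro h
    apply hconst
    intro i hi i' hi'
    have h1 := hmemW.1 hi
    have h2 := hmemW.1 hi'
    rw [hbN i h1.1 h1.2.1 h1.2.2, hbN i' h2.1 h2.2.1 h2.2.2]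
    have := (Int.ModEq.mul_left' (c := (N : ℤ)) (h i hi i' hi')).add_left c
    push_cast
    rwa [mul_comm (q : ℤ)]
  set K : ℤ := ∑ i ∈ Finset.range (q * N), (i : ℤ)
  obtain ⟨x, hx⟩ := exists_mul_modEq_of_isCoprime hco (α - c * K)
  have hN0 : (0 : ℤ) < N := by exact_mod_cast (by omega : 0 < N)
  -- The representative is taken in [1, N] so that it differs from the label 0 of k and lies below
  -- q(N - 1).
  obtain ⟨δ, hδ1, hδN, hδx⟩ : ∃ δ : ℤ, 1 ≤ δ ∧ δ ≤ N ∧ δ ≡ x [ZMOD N] := by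
    refine ⟨(x - 1) % N + 1, ?_, ?_, ?_⟩
    · have := Int.emod_nonneg (x - 1) hN0.ne'; omega
    · have := Int.emod_lt_of_pos (x - 1) hN0; omega
    · simpa using (Int.mod_modEq (x - 1) N).add_right 1
  -- Labels δ and 0 at j and k settle the congruence modulo `N`; the quotient κ is what Σ b y must
  -- equal modulo q.
  obtain ⟨κ, hκ⟩ := ((hδx.mul_left (a j - c)).trans hx).symm.exists_eq_add_mul
  have hN3 : (3 : ℤ) ≤ N := by exact_mod_cast hN
  have hq2' : (2 : ℤ) ≤ q := by exact_mod_cast hq2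
  have hfval : ∀ i ∈ ({j, k} : Finset ι), 0 ≤ (if i = j then δ else 0) ∧
      (if i = j then δ else 0) ≤ (N : ℤ) := by
    intro i _
    split_ifs <;> constructor <;> omega
  obtain ⟨y, hy, hyf, hysum⟩ := exists_solution_mod_prime (W := {j, k}) (a := b)
    (f := fun i => if i = j then δ else 0) hq (by omega) hP
    (distinctModOn_of_lt (fun i hi => (hfval i hi).1)
      (fun i hi => by
        have := (hfval i hi).2
        push_cast
        nlinarith)
      (by
        intro i hi i' hi' h
        simp only [Finset.mem_insert, Finset.mem_singleton] at hi hi'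
        rcases hi with rfl | rfl <;> rcases hi' with rfl | rfl
        · rfl
        · simp [hjk.symm] at h; omega
        · simp [hjk.symm] at h; omega
        · rfl))
    (fun i hi => (hfval i hi).1)
    (fun i hi => by
      have := (hfval i hi).2
      nlinarith)
    (by
      left
      have : q * 3 ≤ q * N := Nat.mul_le_mul_left q hN
      omega) hbne κ
  have hyj : y j = δ := by simpa using hyf j (by simp)
  have hyk : y k = 0 := by simpa [hjk.symm] using hyf k (by simp)
  refine ⟨y, hy, ?_⟩
  have hbj : b j = 0 := by simp [hb]
  have hbk : b k = 0 := by simp [hb]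
  have hexact : ∑ i ∈ P, a i * y i =
      c * ∑ i ∈ P, y i + (a j - c) * y j + (a k - c) * y k + N * ∑ i ∈ P, b i * y i := by
    have hk' : k ∈ P.erase j := Finset.mem_erase.2 ⟨hjk.symm, hk⟩
    rw [← Finset.add_sum_erase P _ hj, ← Finset.add_sum_erase _ _ hk',
      ← Finset.add_sum_erase P y hj, ← Finset.add_sum_erase _ y hk',
      ← Finset.add_sum_erase P (fun i => b i * y i) hj,
      ← Finset.add_sum_erase _ (fun i => b i * y i) hk']
    have : ∑ i ∈ (P.erase j).erase k, a i * y i =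
        c * ∑ i ∈ (P.erase j).erase k, y i + N * ∑ i ∈ (P.erase j).erase k, b i * y i := by
      rw [Finset.mul_sum, Finset.mul_sum, ← Finset.sum_add_distrib]
      refine Finset.sum_congr rfl fun i hi => ?_
      simp only [Finset.mem_erase] at hi
      rw [hbN i hi.2.2 hi.2.1 hi.1]; ring
    rw [this]
    simp only [hbj, hbk]
    ring
  rw [hexact, hyj, hyk]
  have h1 := (hy.sum_modEq hP (by omega)).mul_left c
  have h2 : (N : ℤ) * ∑ i ∈ P, b i * y i ≡ N * κ [ZMOD (q * N : ℕ)] := by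
    push_cast
    rw [mul_comm (q : ℤ)]
    exact Int.ModEq.mul_left' hysum
  have h3 := (h1.add_right ((a j - c) * δ)).add h2
  rw [mul_zero, add_zero]
  convert h3 using 1
  linear_combination hκ

/-- The main theorem modulo `q * N` when there is a class that is exceptional modulo `N` and the
remaining coefficients agree modulo `N`, either with the centre of the class or with `N = 3`. -/
theorem solvableOn_of_exceptional_class {C : Finset ι} {j k l : ι} (hq : q.Prime)
    (hN : 3 ≤ N) (hP : P.card = q * N) (hCP : C ⊆ P) (hC : C.card = N) (hj : j ∈ C) (hk : k ∈ C)
    (hl : l ∈ C) (hjk : j ≠ k) (hjl : j ≠ l) (hkl : k ≠ l) (he : a j + a k ≡ 2 * a l [ZMOD N])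
    (hco : IsCoprime (a j - a l) (N : ℤ)) (hc : ∀ i ∈ C, i ≠ j → i ≠ k → a i ≡ a l [ZMOD N])
    {h : ι} (hout : ∀ i ∈ P \ C, a i ≡ a h [ZMOD N]) (hor : a h ≡ a l [ZMOD N] ∨ N = 3)
    (hs : SpreadOn (q * N) P a) (hex : ¬ ExceptionalOn (q * N) P a) (α : ℤ) :
    SolvableOn (q * N) P a α := by
  by_cases hhl : a h ≡ a l [ZMOD N]
  · refine solvableOn_of_pair_mod hq hN hP (hCP hj) (hCP hk) hjk (fun i hi h1 h2 => ?_) hco hs hex α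
    by_cases hiC : i ∈ C
    · exact hc i hiC h1 h2
    · exact (hout i (Finset.mem_sdiff.2 ⟨hi, hiC⟩)).trans hhl
  have hN3 : N = 3 := hor.resolve_left hhl
  subst hN3
  have hCeq : C = {j, k, l} := by
    symm
    apply Finset.eq_of_subset_of_card_le
    · intro t ht
      simp only [Finset.mem_insert, Finset.mem_singleton] at ht
      rcases ht with rfl | rfl | rfl <;> assumption
    · rw [hC, Finset.card_eq_three.2 ⟨j, k, l, hjk, hjl, hkl, rfl⟩]
  -- recentre at `s`, the element of the class congruent to the outside coefficients
  have main : ∀ s t : ι, s ∈ C → t ∈ C → s ≠ t → t ≠ l → (∀ i ∈ C, i = s ∨ i = t ∨ i = l) →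
      a h ≡ a s [ZMOD (3 : ℕ)] → IsCoprime (a l - a s) ((3 : ℕ) : ℤ) →
      SolvableOn (q * 3) P a α := by
    intro s t hs' ht hst htl hmem hhs hco'
    refine solvableOn_of_pair_mod (c := a s) hq hN hP (hCP hl) (hCP ht) htl.symm
      (fun i hi h1 h2 => ?_) hco' hs hex α
    by_cases hiC : i ∈ C
    · rcases hmem i hiC with rfl | h | h
      · rfl
      · exact absurd h h2
      · exact absurd h h1
    · exact (hout i (Finset.mem_sdiff.2 ⟨hi, hiC⟩)).trans hhs
  have hjl' := not_modEq_of_isCoprime_sub (by omega) hco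
  have hmem : ∀ i ∈ C, i = j ∨ i = k ∨ i = l := by
    intro i hi; rw [hCeq] at hi; simpa using hi
  -- An exceptional class modulo 3 contains all three residues, so an outside coefficient not
  -- congruent to a_l is congruent to a_j or a_k.
  have hcase : a h ≡ a j [ZMOD (3 : ℕ)] ∨ a h ≡ a k [ZMOD (3 : ℕ)] := by
    simp only [Int.ModEq, Nat.cast_ofNat] at hhl hjl' he ⊢
    omega
  rcases hcase with hh | hh
  · exact main j k hj hk hjk hkl hmem hh (by rw [← neg_sub]; exact hco.neg_left)
  · refine main k j hk hj hjk.symm hjl (fun i hi => ?_) hh ?_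
    · rcases hmem i hi with h | h | h <;> tauto
    · rw [← neg_sub]; exact (isCoprime_sub_of_add_modEq he hco).neg_left

/-- The main theorem modulo `q * N` when four coefficients can be set aside, two whose difference is
invertible modulo `N` and two incongruent modulo `N`, with the others not all congruent modulo
`q`. -/
theorem solvableOn_of_four {e g h x : ι}
    (hT : ∀ C : Finset ι, C.card = N → SpreadOn N C a → ¬ ExceptionalOn N C a →
      ∀ β, SolvableOn N C a β)
    (hq : q.Prime) (hN : 3 ≤ N) (hP : P.card = q * N) (he : e ∈ P) (hg : g ∈ P) (hh : h ∈ P)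
    (hx : x ∈ P) (eg : e ≠ g) (eh : e ≠ h) (ex : e ≠ x) (gh : g ≠ h) (gx : g ≠ x) (hxne : h ≠ x)
    (hco : IsCoprime (a e - a g) (N : ℤ)) (hhx : ¬ a h ≡ a x [ZMOD N])
    (hne : ¬ ConstModOn q (P \ {e, g, h, x}) a) (α : ℤ) : SolvableOn (q * N) P a α := by
  have hq2 := hq.two_le
  have hq2' : (2 : ℤ) ≤ q := by exact_mod_cast hq2
  have hN3 : (3 : ℤ) ≤ N := by exact_mod_cast hN
  have h3q : q * 3 ≤ q * N := Nat.mul_le_mul_left q hN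
  -- Labels 0 and q put e, g into class 0, making it spread; labels 1 and q + 1 put h, x into class
  -- 1, making it nonconstant. This rules out the obstruction in `solvableOn_or_of_class`.
  set f : ι → ℤ := fun i => if i = e then 0 else if i = g then q else if i = h then 1 else q + 1
    with hf
  have fe : f e = 0 := by simp [hf]
  have fg : f g = q := by simp [hf, eg.symm]
  have fh : f h = 1 := by simp [hf, eh.symm, gh.symm]
  have fx : f x = q + 1 := by simp [hf, ex.symm, gx.symm, hxne.symm]
  have hmem : ∀ i ∈ ({e, g, h, x} : Finset ι), i = e ∨ i = g ∨ i = h ∨ i = x := by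
    intro i hi; simpa using hi
  have hcard : ({e, g, h, x} : Finset ι).card = 4 := by
    rw [Finset.card_insert_of_notMem (by simp [*]), Finset.card_insert_of_notMem (by simp [*]),
      Finset.card_pair hxne]
  have hsub : ({e, g, h, x} : Finset ι) ⊆ P := by
    intro i hi
    rcases hmem i hi with rfl | rfl | rfl | rfl <;> assumption
  have hf0 : ∀ i ∈ ({e, g, h, x} : Finset ι), 0 ≤ f i := by
    intro i hi
    rcases hmem i hi with rfl | rfl | rfl | rfl <;> omega
  have hflt : ∀ i ∈ ({e, g, h, x} : Finset ι), f i < q * ((N : ℤ) - 1) := by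
    intro i hi
    have : (q : ℤ) + 1 < q * ((N : ℤ) - 1) := by nlinarith
    rcases hmem i hi with rfl | rfl | rfl | rfl <;> omega
  have hcardP := Finset.card_sdiff_add_card_eq_card hsub
  obtain ⟨y, hy, hyf, hysum⟩ := exists_solution_mod_prime (W := {e, g, h, x}) (a := a) (f := f)
    hq (by omega) hP
    (distinctModOn_of_lt hf0
      (fun i hi => by
        have := hflt i hi
        push_cast
        nlinarith)
      (by
        intro i hi i' hi' hii
        rcases hmem i hi with rfl | rfl | rfl | rfl <;>
          rcases hmem i' hi' with rfl | rfl | rfl | rfl <;> first | rfl | (exfalso; omega)))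
    hf0 hflt (by omega) hne α
  have ye : y e = 0 := by rw [hyf e (by simp), fe]
  have yg : y g = q := by rw [hyf g (by simp), fg]
  have yh : y h = 1 := by rw [hyf h (by simp), fh]
  have yx : y x = q + 1 := by rw [hyf x (by simp), fx]
  rcases solvableOn_or_of_class (r := 0) hT hP hq.pos (by omega) hy hysum
    (spreadOn_of_isCoprime (i := e) (j := g) (mem_residueClass.2 ⟨he, by rw [ye]⟩)
      (mem_residueClass.2 ⟨hg, by rw [yg]; simp [Int.ModEq]⟩) hco) with h1 | h1
  · exact h1
  · refine absurd (h1.2 h hh x hx ?_ ?_) hhx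
    · rw [yh]
      intro h2
      have := Int.le_of_dvd (by norm_num) h2.symm.dvd
      omega
    · rw [yh, yx]
      simp [Int.ModEq]

/-- One witness incongruent to a_b for each prime factor of `N`, together with b itself, suffices.
-/
theorem exists_spreadOn_subset (hs : SpreadOn N P a) (hN : N ≠ 0) {b : ι} (hb : b ∈ P) :
    ∃ R ⊆ P, b ∈ R ∧ R.card ≤ N.primeFactors.card + 1 ∧ SpreadOn N R a := by
  have hex : ∀ p : ℕ, ∃ i ∈ P, p ∈ N.primeFactors → ¬ a i ≡ a b [ZMOD p] := by
    intro p
    by_cases hp : p ∈ N.primeFactors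
    · have := hs p (Nat.prime_of_mem_primeFactors hp) (Nat.dvd_of_mem_primeFactors hp)
      by_contra! hcon
      exact this fun i hi j hj => ((hcon i hi).2).trans ((hcon j hj).2).symm
    · exact ⟨b, hb, fun h => absurd h hp⟩
  choose g hgP hg using hex
  refine ⟨insert b (N.primeFactors.image g), ?_, Finset.mem_insert_self _ _, ?_, ?_⟩
  · intro i hi
    rcases Finset.mem_insert.1 hi with rfl | hi
    · exact hb
    · obtain ⟨p, -, rfl⟩ := Finset.mem_image.1 hi
      exact hgP p
  · exact (Finset.card_insert_le _ _).trans (Nat.add_le_add_right Finset.card_image_le 1)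
  · intro p hp hd hc
    have hmem : p ∈ N.primeFactors := Nat.mem_primeFactors.2 ⟨hp, hd, hN⟩
    exact hg p hmem (hc _ (Finset.mem_insert_of_mem (Finset.mem_image_of_mem g hmem)) _
      (Finset.mem_insert_self _ _))

theorem card_primeFactors_add_one_le (hN : 2 ≤ N) : N.primeFactors.card + 1 ≤ N := by
  have : N.primeFactors ⊆ Finset.Icc 2 N := by
    intro p hp
    exact Finset.mem_Icc.2 ⟨(Nat.prime_of_mem_primeFactors hp).two_le,
      Nat.le_of_mem_primeFactors hp⟩
  have := Finset.card_le_card this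
  rw [Nat.card_Icc] at this
  omega

/-- N - 1 is at least 2 and coprime to N, so it is one more non-divisor in [2, N]. The gain leaves
room below the top block of labels. -/
theorem card_primeFactors_add_two_le (hN : 3 ≤ N) : N.primeFactors.card + 2 ≤ N := by
  have : N.primeFactors ⊆ (Finset.Icc 2 N).erase (N - 1) := by
    intro p hp
    refine Finset.mem_erase.2 ⟨?_, Finset.mem_Icc.2 ⟨(Nat.prime_of_mem_primeFactors hp).two_le,
      Nat.le_of_mem_primeFactors hp⟩⟩
    rintro rfl
    have h1 := Nat.dvd_of_mem_primeFactors hp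
    have h2 := (Nat.dvd_sub h1 dvd_rfl)
    have h3 : N - (N - 1) = 1 := by omega
    rw [h3, Nat.dvd_one] at h2
    omega
  have := Finset.card_le_card this
  rw [Finset.card_erase_of_mem (Finset.mem_Icc.2 ⟨by omega, by omega⟩), Nat.card_Icc] at this
  omega

end Induction

/-! ### The induction on the modulus -/

section MainTheorem

variable {ι : Type*} [DecidableEq ι] {q N : ℕ} {P : Finset ι} {a : ι → ℤ}

theorem exists_mem_ne_residueClass {y : ι → ℤ} (hy : DistinctModOn (q * N) P y)
    (hP : P.card = q * N) (hq : 0 < q) (hN : 2 ≤ N) (g : ι) :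
    ∃ g' ∈ P, g' ≠ g ∧ y g' ≡ y g [ZMOD q] := by
  have hcard := hy.card_residueClass hP hq (by omega) (y g)
  obtain ⟨g', hg', hne⟩ := Finset.exists_mem_ne (by omega : 1 < (residueClass q P y (y g)).card) g
  exact ⟨g', (mem_residueClass.1 hg').1, hne, (mem_residueClass.1 hg').2⟩

/-- The induction step when all but one coefficient agree modulo a prime factor `q`. -/
theorem solvableOn_of_single_mod {b : ι} {c : ℤ}
    (hT : ∀ C : Finset ι, C.card = N → SpreadOn N C a → ¬ ExceptionalOn N C a →
      ∀ β, SolvableOn N C a β)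
    (hq : q.Prime) (hN : 2 ≤ N) (hP : P.card = q * N) (hb : b ∈ P)
    (hc : ∀ i ∈ P, i ≠ b → a i ≡ c [ZMOD q]) (hs : SpreadOn (q * N) P a)
    (hex : ¬ ExceptionalOn (q * N) P a) (α : ℤ) : SolvableOn (q * N) P a α := by
  have hq2 := hq.two_le
  have hqN : 2 * N ≤ q * N := Nat.mul_le_mul_right N hq2
  set K : ℤ := ∑ i ∈ Finset.range (q * N), (i : ℤ)
  have hbc : IsCoprime (a b - c) (q : ℤ) := by
    rw [isCoprime_natPrime_iff hq]
    intro h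
    have hbc : a b ≡ c [ZMOD q] := by simpa using h.add_right c
    have : ∀ i ∈ P, a i ≡ c [ZMOD q] := by
      intro i hi
      by_cases hib : i = b
      · rw [hib]; exact hbc
      · exact hc i hi hib
    exact hs q hq (dvd_mul_right q N) fun i hi j hj => (this i hi).trans (this j hj).symm
  -- Modulo q the weighted sum depends only on the label of b, so r is the class that b must occupy;
  -- a spread set containing b fits into that class.
  obtain ⟨r, hr⟩ := exists_mul_modEq_of_isCoprime hbc (α - c * K)
  have hsum : ∀ y, DistinctModOn (q * N) P y → y b ≡ r [ZMOD q] →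
      ∑ i ∈ P, a i * y i ≡ α [ZMOD q] := by
    intro y hy hyb
    refine (sum_modEq_of_single hb hc y).trans ?_
    have h1 := ((hy.sum_modEq hP (by omega)).of_dvd_nat (dvd_mul_right q N)).mul_left c
    have h2 := h1.add ((hyb.mul_left (a b - c)).trans hr)
    rwa [add_sub_cancel] at h2
  obtain ⟨R, hRP, hbR, hRcard, hRs⟩ :=
    exists_spreadOn_subset (hs.of_dvd (dvd_mul_left N q)) (by omega) hb
  have hRN : R.card ≤ N := hRcard.trans (card_primeFactors_add_one_le hN)
  obtain ⟨z, hz, hzlt, -⟩ := exists_label_extend (W := ∅) (Q := R) (f := 0) (by simp) (by simp)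
    (by simp)
  obtain ⟨y, hy, hyf⟩ := DistinctModOn.exists_extend (W := R) (f := fun i => r + q * z i) hP
    (by omega) (by
      intro i hi j hj hij
      rw [add_mul_modEq_iff hq.pos, Int.natCast_modEq_iff] at hij
      have h1 := hzlt i hi
      have h2 := hzlt j hj
      exact hz hi hj (hij.eq_of_lt_of_lt (by omega) (by omega)))
  have hyR : ∀ i ∈ R, y i ≡ r [ZMOD q] := by
    intro i hi
    rw [hyf i hi]
    exact Int.modEq_iff_dvd.2 ⟨-z i, by ring⟩
  set C := residueClass q P y r with hC
  have hCP : C ⊆ P := residueClass_subset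
  have hCcard : C.card = N := hy.card_residueClass hP hq.pos (by omega) r
  have hCs : SpreadOn N C a := hRs.mono fun i hi => mem_residueClass.2 ⟨hRP hi, hyR i hi⟩
  have hbC : b ∈ C := mem_residueClass.2 ⟨hb, hyR b hbR⟩
  rcases solvableOn_or_of_class hT hP hq.pos (by omega) hy (hsum y hy (hyR b hbR)) hCs with
    h1 | ⟨hexC, hother⟩
  · exact h1
  have hN3 := hexC.three_le hCcard
  obtain ⟨j, hj, k, hk, l, hl, hjk, hjl, hkl, he, hco, hcl⟩ := hexC
  -- exchanging the labels of `g` and `h`, with `h` outside the class, separates `g` from the rest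
  -- of the class that `h` leaves
  have swap : ∀ g ∈ P, ∀ h ∈ P, g ≠ b → ¬ y h ≡ r [ZMOD q] → ¬ a g ≡ a h [ZMOD N] →
      SpreadOn N (residueClass q P (fun i => y (Equiv.swap g h i)) r) a →
      SolvableOn (q * N) P a α := by
    intro g hg h hh hgb hhr hagh hspread
    have hgh : g ≠ h := fun e => hagh (e ▸ rfl)
    have hhb : h ≠ b := by rintro rfl; exact hhr (hyR _ hbR)
    have hy' := hy.comp_swap hg hh
    have hyb' : y (Equiv.swap g h b) ≡ r [ZMOD q] := by
      rw [Equiv.swap_apply_of_ne_of_ne hgb.symm hhb.symm]; exact hyR b hbR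
    rcases solvableOn_or_of_class hT hP hq.pos (by omega) hy' (hsum _ hy' hyb') hspread with
      h1 | ⟨-, h1⟩
    · exact h1
    obtain ⟨h', hh', hne, hmod⟩ := exists_mem_ne_residueClass hy hP hq.pos hN h
    have ha : a h ≡ a h' [ZMOD N] := hother h hh h' hh' hhr hmod.symm
    have hne' : h' ≠ g := by rintro rfl; exact hagh ha.symm
    have h2 := h1 g hg h' hh' (by simpa using hhr) (by
      simp only [Equiv.swap_apply_left]
      rw [Equiv.swap_apply_of_ne_of_ne hne' hne]
      exact hmod.symm)
    exact absurd (h2.trans ha.symm) hagh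
  by_cases hout : ∃ g ∈ P \ C, ∃ h ∈ P \ C, ¬ a g ≡ a h [ZMOD N]
  · obtain ⟨g, hg, h, hh, hagh⟩ := hout
    rw [Finset.mem_sdiff] at hg hh
    have hgr : ¬ y g ≡ r [ZMOD q] := fun h' => hg.2 (mem_residueClass.2 ⟨hg.1, h'⟩)
    have hhr : ¬ y h ≡ r [ZMOD q] := fun h' => hh.2 (mem_residueClass.2 ⟨hh.1, h'⟩)
    refine swap g hg.1 h hh.1 (fun e => hg.2 (e ▸ hbC)) hhr hagh (hCs.mono fun i hi => ?_)
    refine mem_residueClass.2 ⟨hCP hi, ?_⟩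
    have hig : i ≠ g := by rintro rfl; exact hg.2 hi
    have hih : i ≠ h := by rintro rfl; exact hh.2 hi
    rw [Equiv.swap_apply_of_ne_of_ne hig hih]
    exact (mem_residueClass.1 hi).2
  push Not at hout
  obtain ⟨h, hh⟩ : (P \ C).Nonempty := by
    rw [← Finset.card_pos]
    have := Finset.card_sdiff_add_card_eq_card hCP
    omega
  by_cases hcentre : a h ≡ a l [ZMOD N] ∨ N = 3
  · exact solvableOn_of_exceptional_class hq hN3 hP hCP hCcard hj hk hl hjk hjl hkl he hco hcl
      (fun i hi => hout i hi h hh) hcentre hs hex α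
  push Not at hcentre
  have hsubC : ({j, k} : Finset ι) ⊆ C := by
    intro t ht
    simp only [Finset.mem_insert, Finset.mem_singleton] at ht
    rcases ht with rfl | rfl <;> assumption
  have hcardC := Finset.card_sdiff_add_card_eq_card hsubC
  rw [Finset.card_pair hjk] at hcardC
  -- Here N ≥ 4, so there are two central indices: x ≠ b, which is traded for h outside, and l',
  -- which stays so that j and l' keep the class spread.
  obtain ⟨x, hx, hxb⟩ := Finset.exists_mem_ne (by omega : 1 < (C \ {j, k}).card) b
  obtain ⟨l', hl', hl'x⟩ := Finset.exists_mem_ne (by omega : 1 < (C \ {j, k}).card) x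
  simp only [Finset.mem_sdiff, Finset.mem_insert, Finset.mem_singleton, not_or] at hx hl' hh
  have hax := hcl x hx.1 hx.2.1 hx.2.2
  have hal' := hcl l' hl'.1 hl'.2.1 hl'.2.2
  refine swap x (hCP hx.1) h hh.1 hxb (fun h' => hh.2 (mem_residueClass.2 ⟨hh.1, h'⟩))
    (fun h' => hcentre.1 (h'.symm.trans hax)) ?_
  have hmem : ∀ i ∈ C, i ≠ x → i ∈ residueClass q P (fun i => y (Equiv.swap x h i)) r := by
    intro i hi hix
    refine mem_residueClass.2 ⟨hCP hi, ?_⟩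
    have hih : i ≠ h := by rintro rfl; exact hh.2 hi
    rw [Equiv.swap_apply_of_ne_of_ne hix hih]
    exact (mem_residueClass.1 hi).2
  exact spreadOn_of_isCoprime (hmem j hj (Ne.symm hx.2.1)) (hmem l' hl'.1 hl'x)
    ((hal'.symm.sub_left (a j)).isCoprime hco)

/-- If no prime factor of `q * N` singles out one coefficient, then two coefficients incongruent
modulo `q` can be removed without the others becoming congruent modulo a prime factor of `N`. -/
theorem exists_pair_spreadOn_sdiff (hq : q.Prime) (hN : 3 ≤ N) (hP : P.card = q * N)
    (hs : SpreadOn (q * N) P a)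
    (hno : ∀ p : ℕ, p.Prime → p ∣ q * N → ∀ b ∈ P, ¬ ConstModOn p (P.erase b) a) :
    ∃ u ∈ P, ∃ v ∈ P, ¬ a u ≡ a v [ZMOD q] ∧ SpreadOn N (P \ {u, v}) a := by
  by_contra! hcon
  have hq2 := hq.two_le
  have hqN : 2 * N ≤ q * N := Nat.mul_le_mul_right N hq2
  -- Each v incongruent to u modulo q has a prime factor p of `N` with all of `P` except u, v
  -- constant modulo p. Two such v cannot share p, for then p would single out u.
  have hcount : ∀ u ∈ P, (P.filter fun v => ¬ a u ≡ a v [ZMOD q]).card ≤ N.primeFactors.card := by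
    intro u hu
    have hex : ∀ v, ∃ p : ℕ, v ∈ P.filter (fun v => ¬ a u ≡ a v [ZMOD q]) →
        p ∈ N.primeFactors ∧ ConstModOn p (P \ {u, v}) a := by
      intro v
      by_cases hv : v ∈ P.filter (fun v => ¬ a u ≡ a v [ZMOD q])
      · obtain ⟨hvP, huv⟩ := Finset.mem_filter.1 hv
        have := hcon u hu v hvP huv
        unfold SpreadOn at this
        push Not at this
        obtain ⟨p, hp, hpd, hpc⟩ := this
        exact ⟨p, fun _ => ⟨Nat.mem_primeFactors.2 ⟨hp, hpd, by omega⟩, hpc⟩⟩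
      · exact ⟨0, fun h => absurd h hv⟩
    choose p hp using hex
    refine Finset.card_le_card_of_injOn p (fun v hv => (hp v hv).1) ?_
    intro v hv v' hv' hvv'
    by_contra hne
    have h1 := hp v hv
    have h2 := hp v' hv'
    rw [← hvv'] at h2
    refine hno (p v) (Nat.prime_of_mem_primeFactors h1.1)
      ((Nat.dvd_of_mem_primeFactors h1.1).trans (dvd_mul_left N q)) u hu ?_
    obtain ⟨m, hm, hm'⟩ := Finset.exists_mem_notMem_of_card_lt_card
      (lt_of_le_of_lt (Finset.card_le_three (a := u) (b := v) (c := v')) (by omega : 3 < P.card))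
    simp only [Finset.mem_insert, Finset.mem_singleton, not_or] at hm'
    have key : ∀ i ∈ P.erase u, a i ≡ a m [ZMOD p v] := by
      intro i hi
      rw [Finset.mem_erase] at hi
      by_cases hiv : i = v
      · have hiv' : i ≠ v' := fun h => hne (hiv.symm.trans h)
        exact h2.2 i (by simp [hi, hiv']) m (by simp [hm, hm'])
      · exact h1.2 i (by simp [hi, hiv]) m (by simp [hm, hm'])
    exact fun i hi i' hi' => (key i hi).trans (key i' hi').symm
  have hnc := hs q hq (dvd_mul_right q N)
  unfold ConstModOn at hnc
  push Not at hnc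
  obtain ⟨u, hu, u', hu', huu'⟩ := hnc
  -- No index is congruent modulo q to both u and u', so |P| is at most twice the number of prime
  -- factors of `N`, which is below 2N.
  have hcover : P ⊆ (P.filter fun v => ¬ a u ≡ a v [ZMOD q]) ∪
      (P.filter fun v => ¬ a u' ≡ a v [ZMOD q]) := by
    intro i hi
    simp only [Finset.mem_union, Finset.mem_filter]
    by_contra! h
    exact huu' ((h.1 hi).trans (h.2 hi).symm)
  have h1 := (Finset.card_le_card hcover).trans (Finset.card_union_le _ _)
  have h2 := hcount u hu
  have h3 := hcount u' hu'
  have h4 := card_primeFactors_add_two_le hN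
  omega

/-- The induction step when no prime factor singles out one coefficient. -/
theorem solvableOn_of_no_single_mod
    (hT : ∀ C : Finset ι, C.card = N → SpreadOn N C a → ¬ ExceptionalOn N C a →
      ∀ β, SolvableOn N C a β)
    (hq : q.Prime) (hN : 3 ≤ N) (hqN : q ≤ N) (hP : P.card = q * N) (hs : SpreadOn (q * N) P a)
    (hex : ¬ ExceptionalOn (q * N) P a)
    (hno : ∀ p : ℕ, p.Prime → p ∣ q * N → ∀ b ∈ P, ¬ ConstModOn p (P.erase b) a) (α : ℤ) :
    SolvableOn (q * N) P a α := by
  have hq2 := hq.two_le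
  have h2N : 2 * N ≤ q * N := Nat.mul_le_mul_right N hq2
  -- The spread set is taken from outside u, v, so that these two remain free and the free
  -- coefficients are not constant modulo q.
  obtain ⟨u, hu, v, hv, huv, hspread⟩ := exists_pair_spreadOn_sdiff hq hN hP hs hno
  obtain ⟨b, hb, hb'⟩ := Finset.exists_mem_notMem_of_card_lt_card
    (lt_of_le_of_lt (Finset.card_le_two (a := u) (b := v)) (by omega : 2 < P.card))
  obtain ⟨R, hRP, -, hRcard, hRs⟩ := exists_spreadOn_subset hspread (by omega)
    (Finset.mem_sdiff.2 ⟨hb, hb'⟩)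
  have hRP' : R ⊆ P := hRP.trans Finset.sdiff_subset
  have hRN : R.card + 1 ≤ N := by
    have := card_primeFactors_add_two_le hN
    omega
  obtain ⟨z, hz, hzlt, -⟩ := exists_label_extend (W := ∅) (Q := R) (f := 0) (by simp) (by simp)
    (by simp)
  have hq0 : (0 : ℤ) < q := by exact_mod_cast hq.pos
  have hzN : ∀ i ∈ R, (q : ℤ) * z i < q * ((N : ℤ) - 1) := by
    intro i hi
    have h1 := hzlt i hi
    have : (z i : ℤ) < (N : ℤ) - 1 := by omega
    exact mul_lt_mul_of_pos_left this hq0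
  obtain ⟨y, hy, hyf, hysum⟩ := exists_solution_mod_prime (W := R) (a := a)
    (f := fun i => q * (z i : ℤ)) hq (by omega) hP
    (distinctModOn_of_lt (fun i _ => by positivity)
      (fun i hi => by
        have := hzN i hi
        push_cast
        linarith)
      (fun i hi j hj hij => hz hi hj (by exact_mod_cast mul_left_cancel₀ hq0.ne' hij)))
    (fun i _ => by positivity) hzN
    (by
      have h1 := Finset.card_sdiff_add_card_eq_card hRP'
      by_cases h2 : q = 2
      · exact Or.inr h2
      · left
        have h3 : 3 * N ≤ q * N := Nat.mul_le_mul_right N (by omega)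
        have h4 : q * 3 ≤ q * N := Nat.mul_le_mul_left q hN
        have h5 : (q - 1) * 3 ≤ (q - 1) * N := Nat.mul_le_mul_left _ hN
        have h6 : q * N = (q - 1) * N + N := by
          rw [← Nat.succ_mul, Nat.succ_eq_add_one, Nat.sub_add_cancel (by omega)]
        omega)
    (fun h => huv (h u (Finset.mem_sdiff.2 ⟨hu, fun h' => by simpa using hRP h'⟩) v
      (Finset.mem_sdiff.2 ⟨hv, fun h' => by simpa using hRP h'⟩))) α
  set C := residueClass q P y 0 with hC
  have hCP : C ⊆ P := residueClass_subset
  have hCcard : C.card = N := hy.card_residueClass hP hq.pos (by omega) 0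
  have hCs : SpreadOn N C a := hRs.mono fun i hi =>
    mem_residueClass.2 ⟨hRP' hi, by rw [hyf i hi]; simp [Int.ModEq]⟩
  rcases solvableOn_or_of_class hT hP hq.pos (by omega) hy hysum hCs with h1 | ⟨hexC, hother⟩
  · exact h1
  obtain ⟨j, hj, k, hk, l, hl, hjk, hjl, hkl, he, hco, hcl⟩ := hexC
  have hco' := isCoprime_sub_of_add_modEq he hco
  have centre : ∀ h : ι, (∀ i ∈ P \ C, a i ≡ a h [ZMOD N]) → (a h ≡ a l [ZMOD N] ∨ N = 3) →
      SolvableOn (q * N) P a α := fun h hout hor =>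
    solvableOn_of_exceptional_class hq hN hP hCP hCcard hj hk hl hjk hjl hkl he hco hcl
      hout hor hs hex α
  by_cases hall : ∀ i ∈ P \ C, a i ≡ a l [ZMOD N]
  · exact centre l hall (Or.inl rfl)
  push Not at hall
  obtain ⟨h₀, hh₀, hah₀⟩ := hall
  have hh₀' := Finset.mem_sdiff.1 hh₀
  have hh₀r : ¬ y h₀ ≡ 0 [ZMOD q] := fun h' => hh₀'.2 (mem_residueClass.2 ⟨hh₀'.1, h'⟩)
  have hcls : ∀ h ∈ residueClass q P y (y h₀), h ∈ P ∧ h ∉ C ∧ ¬ a h ≡ a l [ZMOD N] := by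
    intro h hh
    obtain ⟨h1, h2⟩ := mem_residueClass.1 hh
    refine ⟨h1, fun h3 => hh₀r (h2.symm.trans (mem_residueClass.1 h3).2), fun h3 => hah₀ ?_⟩
    exact (hother h₀ hh₀'.1 h h1 hh₀r h2.symm).trans h3
  obtain ⟨h₁, h₂, h₃, hh₁, hh₂, hh₃, h12, h13, h23⟩ := Finset.two_lt_card_iff.1
    (by rw [hy.card_residueClass hP hq.pos (by omega) (y h₀)]; omega :
      2 < (residueClass q P y (y h₀)).card)
  have hneC : ∀ {s h : ι}, s ∈ C → h ∈ residueClass q P y (y h₀) → s ≠ h := by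
    rintro s h hs' hh rfl
    exact (hcls s hh).2.1 hs'
  have hjkN : ¬ a j ≡ a k [ZMOD N] := by
    intro h
    have h1 : 2 * (a j - a l) ≡ 0 [ZMOD N] := by
      have := ((h.add_left (a j)).trans he).sub_right (2 * a l)
      convert this using 1 <;> ring
    have h2 := hco.symm.dvd_of_dvd_mul_right (Int.modEq_zero_iff_dvd.1 h1)
    have := Int.le_of_dvd (by norm_num) h2
    omega
  -- set aside both deviating indices, one central index and one index outside the class
  have four : ∀ l' ∈ C, l' ≠ j → l' ≠ k → ∀ h ∈ residueClass q P y (y h₀),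
      ¬ ConstModOn q (P \ {j, k, l', h}) a → SolvableOn (q * N) P a α := by
    intro l' hl' hlj hlk h hh hnc
    have hal' := hcl l' hl' hlj hlk
    have hset₁ : ({j, l', k, h} : Finset ι) = {j, k, l', h} := by
      ext; simp only [Finset.mem_insert, Finset.mem_singleton]; tauto
    have hset₂ : ({k, l', j, h} : Finset ι) = {j, k, l', h} := by
      ext; simp only [Finset.mem_insert, Finset.mem_singleton]; tauto
    by_cases hak : a k ≡ a h [ZMOD N]
    · exact solvableOn_of_four hT hq hN hP (hCP hk) (hCP hl') (hCP hj) (hcls h hh).1 hlk.symm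
        hjk.symm (hneC hk hh) hlj (hneC hl' hh) (hneC hj hh)
        ((hal'.symm.sub_left (a k)).isCoprime hco') (fun h' => hjkN (h'.trans hak.symm))
        (by rwa [hset₂]) α
    · exact solvableOn_of_four hT hq hN hP (hCP hj) (hCP hl') (hCP hk) (hcls h hh).1 hlj.symm
        hjk (hneC hj hh) hlk (hneC hl' hh) (hneC hk hh)
        ((hal'.symm.sub_left (a j)).isCoprime hco) hak (by rwa [hset₁]) α
  by_cases hA₁ : ConstModOn q (P \ {j, k, l, h₁}) a
  swap
  · exact four l hl hjl.symm hkl.symm h₁ hh₁ hA₁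
  by_cases hA₂ : ConstModOn q (P \ {j, k, l, h₂}) a
  swap
  · exact four l hl hjl.symm hkl.symm h₂ hh₂ hA₂
  -- Both attempts at setting four indices aside have failed; overlapping them through h₃ shows that
  -- q sees a single value away from j, k, l.
  have hrest : ∀ i ∈ P, i ≠ j → i ≠ k → i ≠ l → a i ≡ a h₃ [ZMOD q] := by
    intro i hi h1 h2 h3
    have m1 : h₃ ∈ P \ {j, k, l, h₁} := by
      simp [(hcls h₃ hh₃).1, (hneC hj hh₃).symm, (hneC hk hh₃).symm, (hneC hl hh₃).symm, h13.symm]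
    have m2 : h₃ ∈ P \ {j, k, l, h₂} := by
      simp [(hcls h₃ hh₃).1, (hneC hj hh₃).symm, (hneC hk hh₃).symm, (hneC hl hh₃).symm, h23.symm]
    by_cases h4 : i = h₁
    · have h5 : i ≠ h₂ := fun h => h12 (h4.symm.trans h)
      exact hA₂ i (by simp [hi, h1, h2, h3, h5]) h₃ m2
    · exact hA₁ i (by simp [hi, h1, h2, h3, h4]) h₃ m1
  by_cases hN3 : N = 3
  · refine centre h₃ (fun i hi => ?_) (Or.inr hN3)
    rw [Finset.mem_sdiff] at hi
    have hi' : ¬ y i ≡ 0 [ZMOD q] := fun h' => hi.2 (mem_residueClass.2 ⟨hi.1, h'⟩)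
    by_cases hq3 : q = 3
    · rw [hN3, ← hq3]
      exact hrest i hi.1 (fun e => hi.2 (e ▸ hj)) (fun e => hi.2 (e ▸ hk))
        (fun e => hi.2 (e ▸ hl))
    · have hq2' : q = 2 := by omega
      have hh₃' : ¬ y h₃ ≡ 0 [ZMOD q] := fun h' =>
        (hcls h₃ hh₃).2.1 (mem_residueClass.2 ⟨(hcls h₃ hh₃).1, h'⟩)
      refine hother i hi.1 h₃ (hcls h₃ hh₃).1 hi' ?_
      simp only [hq2', Int.ModEq, Nat.cast_ofNat] at hi' hh₃' ⊢
      omega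
  have hsub3 : ({j, k, l} : Finset ι).card < C.card := by
    have := Finset.card_le_three (a := j) (b := k) (c := l)
    omega
  obtain ⟨x, hx, hx'⟩ := Finset.exists_mem_notMem_of_card_lt_card hsub3
  simp only [Finset.mem_insert, Finset.mem_singleton, not_or] at hx'
  -- Some index of the class must disagree with h₃ modulo q and be left free. If l agrees, k cannot,
  -- since q would single out j; if l disagrees, x replaces it among the four.
  by_cases hlq : a l ≡ a h₃ [ZMOD q]
  · have hkq : ¬ a k ≡ a h₃ [ZMOD q] := by
      intro hkq
      have key : ∀ i ∈ P.erase j, a i ≡ a h₃ [ZMOD q] := by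
        intro i hi
        rw [Finset.mem_erase] at hi
        by_cases h1 : i = k
        · rw [h1]; exact hkq
        by_cases h2 : i = l
        · rw [h2]; exact hlq
        exact hrest i hi.2 hi.1 h1 h2
      exact hno q hq (dvd_mul_right q N) j (hCP hj)
        fun i hi i' hi' => (key i hi).trans (key i' hi').symm
    refine solvableOn_of_four hT hq hN hP (hCP hj) (hCP hl) (hcls h₁ hh₁).1 (hCP hx) hjl
      (hneC hj hh₁) (Ne.symm hx'.1) (hneC hl hh₁) (Ne.symm hx'.2.2) (hneC hx hh₁).symm hco
      (fun h' => (hcls h₁ hh₁).2.2 (h'.trans (hcl x hx hx'.1 hx'.2.1))) ?_ α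
    intro hconst
    exact hkq (hconst k (by
        simp [hCP hk, hjk.symm, hkl, hneC hk hh₁, Ne.symm hx'.2.1]) h₃ (by
        simp [(hcls h₃ hh₃).1, (hneC hj hh₃).symm, (hneC hl hh₃).symm, h13.symm,
          (hneC hx hh₃).symm]))
  · refine four x hx hx'.1 hx'.2.1 h₁ hh₁ fun hconst => hlq (hconst l ?_ h₃ ?_)
    · simp [hCP hl, hjl.symm, hkl.symm, Ne.symm hx'.2.2, hneC hl hh₁]
    · simp [(hcls h₃ hh₃).1, (hneC hj hh₃).symm, (hneC hk hh₃).symm, (hneC hx hh₃).symm, h13.symm]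

/-- This is the case q = N = 2, too small for the general step. Four distinct coefficients exhaust
ℤ/4, leaving a finite check over permutations; otherwise two coefficients agree and the other two
are the deviating pair. -/
theorem solvableOn_four (hP : P.card = 4) (hs : SpreadOn 4 P a) (hex : ¬ ExceptionalOn 4 P a)
    (α : ℤ) : SolvableOn 4 P a α := by
  by_cases hd : DistinctModOn 4 P a
  · have hperm : ∀ α : ZMod 4, ∃ σ : Equiv.Perm (ZMod 4), ∑ r, r * σ r = α := by decide
    obtain ⟨σ, hσ⟩ := hperm α
    have hcast : ∀ i, (((σ (a i : ZMod 4)).val : ℤ) : ZMod 4) = σ (a i) := by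
      intro i
      rw [Int.cast_natCast, ZMod.natCast_zmod_val]
    refine ⟨fun i => ((σ (a i : ZMod 4)).val : ℤ), ?_, ?_⟩
    · intro i hi j hj hij
      have h1 := (ZMod.intCast_eq_intCast_iff _ _ 4).2 hij
      rw [hcast, hcast] at h1
      exact hd.injOn_cast hi hj (σ.injective h1)
    · rw [← ZMod.intCast_eq_intCast_iff, ← hσ, ← hd.image_cast hP,
        Finset.sum_image hd.injOn_cast, Int.cast_sum]
      refine Finset.sum_congr rfl fun i _ => ?_
      rw [Int.cast_mul, hcast]
  · unfold DistinctModOn at hd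
    push Not at hd
    obtain ⟨i, hi, j, hj, hij, hne⟩ := hd
    have hsub : ({i, j} : Finset ι) ⊆ P := by
      intro t ht
      simp only [Finset.mem_insert, Finset.mem_singleton] at ht
      rcases ht with rfl | rfl <;> assumption
    have hcard := Finset.card_sdiff_add_card_eq_card hsub
    rw [Finset.card_pair hne] at hcard
    obtain ⟨k, l, hkl, hPkl⟩ := Finset.card_eq_two.1 (by omega : (P \ {i, j}).card = 2)
    have hkP : k ∈ P := (Finset.mem_sdiff.1 (hPkl ▸ Finset.mem_insert_self k {l})).1
    have hlP : l ∈ P := (Finset.mem_sdiff.1 (hPkl ▸ (by simp : l ∈ ({k, l} : Finset ι)))).1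
    refine solvableOn_of_pair hP hkP hlP hkl (c := a j) (fun t ht h1 h2 => ?_) hs hex α
    have : t ∉ P \ {i, j} := by rw [hPkl]; simp [h1, h2]
    simp only [Finset.mem_sdiff, ht, true_and, not_not, Finset.mem_insert,
      Finset.mem_singleton] at this
    rcases this with rfl | rfl
    · exact hij
    · rfl

/-- If the differences of the coefficients generate the unit ideal modulo `n` and the coefficients
are not exceptional, then every residue is attained. -/
theorem solvableOn_of_spreadOn (n : ℕ) : ∀ (P : Finset ι), 0 < n → P.card = n →
    SpreadOn n P a → ¬ ExceptionalOn n P a → ∀ α, SolvableOn n P a α := by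
  induction n using Nat.strong_induction_on with
  | _ n ih =>
  intro P hn hP hs hex α
  rcases (by omega : n = 1 ∨ 2 ≤ n) with rfl | hn2
  · obtain ⟨y, hy⟩ := exists_distinctModOn hP hn
    exact ⟨y, hy, by simp [Int.modEq_one]⟩
  by_cases hp : n.Prime
  · exact solvableOn_of_prime hp hP (hs n hp dvd_rfl) hex α
  have hT : ∀ N, N < n → 0 < N → ∀ C : Finset ι, C.card = N → SpreadOn N C a →
      ¬ ExceptionalOn N C a → ∀ β, SolvableOn N C a β := fun N hlt h0 C => ih N hlt C h0
  by_cases hsingle : ∃ p : ℕ, p.Prime ∧ p ∣ n ∧ ∃ b ∈ P, ConstModOn p (P.erase b) a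
  · obtain ⟨q, hq, ⟨N, rfl⟩, b, hb, hconst⟩ := hsingle
    have hN : 2 ≤ N := by
      by_contra! h
      obtain rfl | rfl : N = 0 ∨ N = 1 := by omega
      · omega
      · rw [mul_one] at hp; exact hp hq
    have hlt : N < q * N := by nlinarith [hq.two_le]
    obtain ⟨i₀, hi₀, hi₀b⟩ := Finset.exists_mem_ne (by omega : 1 < P.card) b
    exact solvableOn_of_single_mod (hT N hlt (by omega)) hq hN hP hb
      (fun i hi hib => hconst i (Finset.mem_erase.2 ⟨hib, hi⟩) i₀
        (Finset.mem_erase.2 ⟨hi₀b, hi₀⟩)) hs hex α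
  · push Not at hsingle
    have hq := Nat.minFac_prime (by omega : n ≠ 1)
    have hle := Nat.minFac_le_div hn hp
    obtain ⟨N, hN⟩ := Nat.minFac_dvd n
    rw [Nat.div_eq_of_eq_mul_right hq.pos hN] at hle
    generalize n.minFac = q at hq hle hN
    subst hN
    have hq2 := hq.two_le
    by_cases hN3 : 3 ≤ N
    · exact solvableOn_of_no_single_mod (hT N (by nlinarith) (by omega)) hq hN3 hle hP hs hex
        hsingle α
    -- The least prime factor satisfies q ≤ N, so N < 3 leaves only n = 4.
    · obtain rfl : q = 2 := by omega
      obtain rfl : N = 2 := by omega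
      exact solvableOn_four hP hs hex α

end MainTheorem

/-! ### Translation to the original statement -/

theorem isExceptional_iff_exceptionalOn (n : ℕ) (a : Fin n → ℤ) :
    IsExceptional n a ↔ ExceptionalOn n Finset.univ a := by
  have hiff : ∀ u v w : ℤ, u - w ≡ -v + w [ZMOD n] ↔ u + v ≡ 2 * w [ZMOD n] := by
    intro u v w
    rw [Int.modEq_iff_dvd, Int.modEq_iff_dvd, show -v + w - (u - w) = 2 * w - (u + v) by ring]
  simp only [IsExceptional, ExceptionalOn, Finset.mem_univ, true_and, forall_const, hiff,
    Int.isCoprime_iff_gcd_eq_one]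

theorem hasDistinctSolution_iff_solvableOn (n : ℕ) (a : Fin n → ℤ) (α : ℤ) :
    HasDistinctSolution n a α ↔ SolvableOn n Finset.univ a α := by
  simp only [HasDistinctSolution, SolvableOn, DistinctModOn, Finset.mem_univ, forall_const]
  exact exists_congr fun x => and_congr_left fun _ =>
    forall_congr' fun i => forall_congr' fun j => by tauto

theorem exists_gcd_eq_one_iff_spreadOn {n : ℕ} (hn : 0 < n) (a : Fin n → ℤ) :
    (∃ i : Fin n, Int.gcd (Finset.univ.gcd fun m : Fin n => a m - a i) (n : ℤ) = 1) ↔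
      SpreadOn n Finset.univ a := by
  constructor
  · rintro ⟨i, hi⟩ p hp hd hc
    have h1 : (p : ℤ) ∣ Finset.univ.gcd fun m : Fin n => a m - a i :=
      Finset.dvd_gcd fun m _ => (hc i (Finset.mem_univ _) m (Finset.mem_univ _)).dvd
    have h2 := Int.dvd_coe_gcd h1 (Int.natCast_dvd_natCast.2 hd)
    rw [hi] at h2
    exact hp.one_lt.ne' (Nat.dvd_one.1 (by exact_mod_cast h2))
  · intro hs
    refine ⟨⟨0, hn⟩, ?_⟩
    by_contra hne
    obtain ⟨p, hp, hpd⟩ := Nat.exists_prime_and_dvd hne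
    have hpd' := Int.natCast_dvd_natCast.2 hpd
    have h1 := hpd'.trans (Int.gcd_dvd_left _ _)
    have h2 := Int.natCast_dvd_natCast.1 (hpd'.trans (Int.gcd_dvd_right _ _))
    have key : ∀ m, a m ≡ a ⟨0, hn⟩ [ZMOD p] := fun m =>
      (Int.modEq_iff_dvd.2 (h1.trans (Finset.gcd_dvd (Finset.mem_univ m)))).symm
    exact hs p hp h2 fun i _ j _ => (key i).trans (key j).symm

theorem corollary4p1 (n : ℕ) (hn : 3 ≤ n) (a : Fin n → ℤ) :
    (IsExceptional n a →
      HasDistinctSolution n a 1 ∧ ∃ α : ℤ, α ≠ 1 ∧ ¬ HasDistinctSolution n a α) ∧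
    (¬ IsExceptional n a →
      ((∀ α : ℤ, HasDistinctSolution n a α) ↔
        ∃ i : Fin n, Int.gcd (Finset.univ.gcd fun m : Fin n => a m - a i) (n : ℤ) = 1)) := by
  have hP : (Finset.univ : Finset (Fin n)).card = n := by simp
  simp only [isExceptional_iff_exceptionalOn, hasDistinctSolution_iff_solvableOn,
    exists_gcd_eq_one_iff_spreadOn (by omega : 0 < n)]
  set K : ℤ := ∑ i ∈ Finset.range n, (i : ℤ) with hK
  refine ⟨?_, fun hex => ⟨?_, fun hs α => solvableOn_of_spreadOn n _ (by omega) hP hs hex α⟩⟩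
  · rintro ⟨j, hj, k, hk, l, -, hjk, -, -, he, hco, hc⟩
    have hiff := ExceptionalOn.solvableOn_iff hP hj hk hjk he hco hc
    -- Since 2K = n(n - 1), doubling 1 ≡ a_l K would give n ∣ 2.
    have hne : ¬ 1 ≡ a l * K [ZMOD n] := by
      intro h
      have h2K : 2 * K ≡ 0 [ZMOD n] := by
        have h1 := Finset.sum_range_id_mul_two n
        have h2 : K * 2 = n * ((n - 1 : ℕ) : ℤ) := by
          rw [hK, ← Nat.cast_sum]
          exact_mod_cast h1
        rw [mul_comm, h2]
        exact Int.modEq_zero_iff_dvd.2 (dvd_mul_right _ _)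
      have h3 := (h.mul_left 2).trans
        ((by ring_nf; rfl : 2 * (a l * K) ≡ a l * (2 * K) [ZMOD n]).trans (h2K.mul_left (a l)))
      have h4 : (n : ℤ) ∣ 2 := by simpa using Int.modEq_zero_iff_dvd.1 (by simpa using h3)
      have := Int.le_of_dvd (by norm_num) h4
      omega
    refine ⟨(hiff 1).2 hne, a l * K, fun h => hne (by rw [h]), fun h => (hiff _).1 h rfl⟩
  · intro hall p hp hd hconst
    have hn0 : 0 < n := by omega
    -- With coefficients constant modulo p, every sum is a_0 K modulo p, so the target a_0 K + 1 is
    -- unattainable.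
    obtain ⟨y, hy, hya⟩ := hall (a ⟨0, hn0⟩ * K + 1)
    have h1 := (sum_modEq_of_const (c := a ⟨0, hn0⟩)
      (fun i hi => hconst i hi ⟨0, hn0⟩ (Finset.mem_univ _)) y).trans
      (((hy.sum_modEq hP hn0).of_dvd_nat hd).mul_left _)
    have h2 := h1.symm.trans (hya.of_dvd_nat hd)
    have h3 : (p : ℤ) ∣ 1 := by simpa [hK] using h2.dvd
    exact hp.one_lt.ne' (Nat.dvd_one.1 (by exact_mod_cast h3))
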